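/- Let $V:\mathbb R^2\times\mathbb R\to\mathbb R$, $(z,u)\mapsto V(z,u)$, be a $C^1$ function such that for each $u$ the function $V(\cdot,u)$ is $C^2$ and harmonic on $\mathbb R^2$ (a $z$-harmonic potential). Call $V$ *polynomially $u$-bounded* if for each $u_0\in\mathbb R$ there are $\epsilon_0>0$ and a polynomial $q_0$ on $\mathbb R^2$ with $V(z,u)\le q_0(z)$ for all $z\in\mathbb R^2$, $u\in(u_0-\epsilon_0,u_0+\epsilon_0)$, and *quadratically polynomially $u$-bounded* if, for every $u_0$, $q_0$ can be chosen of degree at most $2$. A trajectory of $V$ is a solution $\gamma$, on an interval, of $\ddot\gamma(s)=-\nabla_zV(\gamma(s),s)$; write $(\rho,\theta)$ for polar coordinates on $\mathbb R^2$. (1) Let $V$ be a $z$-harmonic potential that is polynomially but not quadratically polynomially $u$-bounded. Let $u_0\in\mathbb R$, $\kappa_0>0$ and an integer $n\ge 3$ be such that, for all $u\in I=(u_0-\kappa_0,u_0+\kappa_0)$, all $\rho>0$ and all $\theta\in\mathbb R$, $$V(\rho,\theta,u)=-\lambda(u)\rho^{n}\cos n(\theta+\alpha(u))-\sum_{m=0}^{n-1}\lambda_m(u)\rho^m\cos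 m(\theta+\alpha_m(u))$$ for some real functions $\lambda,\alpha,\lambda_m,\alpha_m$ with $\alpha(u_0)=0$, $\lambda(u_0)>1$ and $\lambda(u)\ge 1$ for all $u\in I$. For $k\in\{0,\dots,n-1\}$ put $$D_k[R,\vartheta]=\{z\in\mathbb R^2:\ \rho(z)>R,\ |\theta(z)-2\pi k/n|<\vartheta\},$$ angles being taken modulo $2\pi$. Then for all $0<\theta_0<\theta_+<\pi/(2n)$ and all $k\in\{0,\dots,n-1\}$ there exists $\rho_0>0$ such that every trajectory $\gamma:[u_0,b)\to\mathbb R^2$, $u_0<b\le\infty$, which is inextensible to the right and satisfies $\gamma(u_0)\in D_k[\rho_0,\theta_0]$, $\dot\rho(u_0)>0$ and $\dot\theta(u_0)=0$, remains in $D_k[\rho_0,\theta_+]$ on all of $[u_0,b)$ and is incomplete, with $b<u_0+\kappa_0$. (2) Consequently, for a $z$-harmonic potential $V$ that is polynomially $u$-bounded, all inextensible trajectories are defined on the whole of $\mathbb R$ if and only if, for each $u\in\mathbb R$, $V(\cdot,u)$ is a polynomial in $z$ of degree at most $2$. -/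

import Mathlib

open Set Complex

noncomputable section

namespace PlanarPotential

/-! The plane `ℝ²` with its Euclidean structure is represented by `ℂ`, `z = x + i y`.
A potential is a function `V : ℂ → ℝ → ℝ`, written `V z u`. -/

/-- The value at the point `z = (x, y)` of a polynomial in `x, y` (variables `0` and `1`). -/
def evalPoly (q : MvPolynomial (Fin 2) ℝ) (z : ℂ) : ℝ :=
  MvPolynomial.eval ![z.re, z.im] q

/-- A `z`-harmonic potential: jointly `C¹` in `(z, u)`, and `C²` and harmonic in `z` for each
fixed `u` (Mathlib's harmonicity contains the `C²` requirement). -/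
structure IsHarmonicPotential (V : ℂ → ℝ → ℝ) : Prop where
  contDiff : ContDiff ℝ 1 (fun p : ℂ × ℝ => V p.1 p.2)
  harmonic : ∀ u : ℝ, InnerProductSpace.HarmonicOnNhd (fun z : ℂ => V z u) univ

/-- Polynomially `u`-bounded: near each `u₀` there is a single polynomial on the plane that is
an upper bound. -/
def PolynomiallyUBounded (V : ℂ → ℝ → ℝ) : Prop :=
  ∀ u₀ : ℝ, ∃ ε > 0, ∃ q : MvPolynomial (Fin 2) ℝ,
    ∀ z : ℂ, ∀ u ∈ Ioo (u₀ - ε) (u₀ + ε), V z u ≤ evalPoly q z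

/-- Quadratically polynomially `u`-bounded: the bounding polynomials can be chosen of degree
at most `2`. -/
def QuadraticallyUBounded (V : ℂ → ℝ → ℝ) : Prop :=
  ∀ u₀ : ℝ, ∃ ε > 0, ∃ q : MvPolynomial (Fin 2) ℝ, q.totalDegree ≤ 2 ∧
    ∀ z : ℂ, ∀ u ∈ Ioo (u₀ - ε) (u₀ + ε), V z u ≤ evalPoly q z

/-- `V(·, u)` is a polynomial in `(x, y)` of degree at most `2`, for each `u`. -/
def AtMostQuadratic (V : ℂ → ℝ → ℝ) : Prop :=
  ∀ u : ℝ, ∃ q : MvPolynomial (Fin 2) ℝ, q.totalDegree ≤ 2 ∧ ∀ z : ℂ, V z u = evalPoly q z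

/-- The point with polar coordinates `(ρ, θ)`. -/
def polarPoint (ρ θ : ℝ) : ℂ := (ρ : ℂ) * Complex.exp ((θ : ℂ) * Complex.I)

/-- For `u ∈ I`, the potential is
`V = -λ(u) ρⁿ cos n(θ + α(u)) - ∑_{m < n} λₘ(u) ρᵐ cos m(θ + αₘ(u))` in polar coordinates. -/
def HasPolarExpression (V : ℂ → ℝ → ℝ) (I : Set ℝ) (n : ℕ) (lam al : ℝ → ℝ)
    (lamLow alLow : ℕ → ℝ → ℝ) : Prop :=
  ∀ u ∈ I, ∀ ρ : ℝ, 0 < ρ → ∀ θ : ℝ,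
    V (polarPoint ρ θ) u =
      -(lam u * ρ ^ n * Real.cos (n * (θ + al u)))
        - ∑ m ∈ Finset.range n, lamLow m u * ρ ^ m * Real.cos (m * (θ + alLow m u))

/-- The polar expression of degree `n` holds on `(u₀ - κ₀, u₀ + κ₀)` with the normalization
`α(u₀) = 0`, `λ(u₀) > 1` and `λ ≥ 1` on that interval. -/
def IsNormalizedAt (V : ℂ → ℝ → ℝ) (n : ℕ) (u₀ κ₀ : ℝ) : Prop :=
  ∃ (lam al : ℝ → ℝ) (lamLow alLow : ℕ → ℝ → ℝ),
    HasPolarExpression V (Ioo (u₀ - κ₀) (u₀ + κ₀)) n lam al lamLow alLow ∧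
    al u₀ = 0 ∧ 1 < lam u₀ ∧ ∀ u ∈ Ioo (u₀ - κ₀) (u₀ + κ₀), 1 ≤ lam u

/-- The open truncated sector of points with radius `> R` and polar angle (modulo `2π`) at
distance `< ϑ` from the principal direction `2πk/n`. -/
def sector (n k : ℕ) (R ϑ : ℝ) : Set ℂ :=
  {z | ∃ ρ θ : ℝ, R < ρ ∧ |θ - 2 * Real.pi * k / n| < ϑ ∧ z = polarPoint ρ θ}

/-- On the interval `J`, `γ` is a solution, with velocity `v`, of `γ'' = -∇_z V(γ(s), s)`.
Only the values on `J` matter; derivatives at end points of `J` are one-sided. -/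
def IsTrajectory (V : ℂ → ℝ → ℝ) (J : Set ℝ) (γ v : ℝ → ℂ) : Prop :=
  ∀ s ∈ J, HasDerivWithinAt γ (v s) J s ∧
    HasDerivWithinAt v (-(gradient (fun z : ℂ => V z s) (γ s))) J s

/-- The interval `[u₀, b)`, where `b = ⊤` is allowed. -/
def rightInterval (u₀ : ℝ) (b : EReal) : Set ℝ := {s : ℝ | u₀ ≤ s ∧ (s : EReal) < b}

/-- The trajectory `γ` on `[u₀, b)` is inextensible to the right: no trajectory on an interval
`[u₀, b')` with `b < b'` coincides with it on `[u₀, b)`. -/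
def IsRightInextensible (V : ℂ → ℝ → ℝ) (u₀ : ℝ) (b : EReal) (γ : ℝ → ℂ) : Prop :=
  ∀ b' : EReal, b < b' → ∀ γ' v' : ℝ → ℂ, IsTrajectory V (rightInterval u₀ b') γ' v' →
    ¬ EqOn γ' γ (rightInterval u₀ b)

/-- A nonempty open interval, bounded or not. -/
def IsOpenInterval (J : Set ℝ) : Prop := IsOpen J ∧ J.OrdConnected ∧ J.Nonempty

/-- The trajectory `γ` on `J` is inextensible: it is not the restriction of a trajectory on a
strictly larger open interval. -/
def IsInextensible (V : ℂ → ℝ → ℝ) (J : Set ℝ) (γ : ℝ → ℂ) : Prop :=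
  ∀ J' : Set ℝ, IsOpenInterval J' → J ⊂ J' → ∀ γ' v' : ℝ → ℂ, IsTrajectory V J' γ' v' →
    ¬ EqOn γ' γ J

/-- All inextensible trajectories are complete, i.e. defined on the whole of `ℝ`. -/
def HasCompleteTrajectories (V : ℂ → ℝ → ℝ) : Prop :=
  ∀ (J : Set ℝ) (γ v : ℝ → ℂ), IsOpenInterval J → IsTrajectory V J γ v →
    IsInextensible V J γ → J = univ

/-- The radial component `ρ'` of the velocity `v` at a point `z ≠ 0`, that is,
`(x x' + y y') / ρ`. -/
def radialVelocity (z v : ℂ) : ℝ := (z.re * v.re + z.im * v.im) / ‖z‖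

/-- The angular velocity `θ'` of the velocity `v` at a point `z ≠ 0`, that is,
`(x y' - y x') / ρ²`. -/
def angularVelocity (z v : ℂ) : ℝ := (z.re * v.im - z.im * v.re) / ‖z‖ ^ 2

/-- For a curve written in polar coordinates, the two preceding notions are `ρ'` and `θ'`. -/
theorem polar_velocity {ρ θ : ℝ → ℝ} {ρ' θ' s : ℝ} {v : ℂ} (hpos : 0 < ρ s)
    (hρ : HasDerivAt ρ ρ' s) (hθ : HasDerivAt θ θ' s)
    (hv : HasDerivAt (fun t => polarPoint (ρ t) (θ t)) v s) :
    radialVelocity (polarPoint (ρ s) (θ s)) v = ρ' ∧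
      angularVelocity (polarPoint (ρ s) (θ s)) v = θ' := by
  have h := (hρ.ofReal_comp).mul ((hθ.ofReal_comp.mul_const Complex.I).cexp)
  have hv' := hv.unique h
  have hn : ‖polarPoint (ρ s) (θ s)‖ = ρ s := by
    simp [polarPoint, Complex.norm_exp_ofReal_mul_I, abs_of_pos hpos]
  have h1 := Real.sin_sq_add_cos_sq (θ s)
  have hre : v.re = ρ' * Real.cos (θ s) - ρ s * θ' * Real.sin (θ s) := by
    rw [hv']
    simp [Complex.exp_ofReal_mul_I_re, Complex.exp_ofReal_mul_I_im]
    ring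
  have him : v.im = ρ' * Real.sin (θ s) + ρ s * θ' * Real.cos (θ s) := by
    rw [hv']
    simp [Complex.exp_ofReal_mul_I_re, Complex.exp_ofReal_mul_I_im]
    ring
  have pre : (polarPoint (ρ s) (θ s)).re = ρ s * Real.cos (θ s) := by
    simp [polarPoint, Complex.exp_ofReal_mul_I_re]
  have pim : (polarPoint (ρ s) (θ s)).im = ρ s * Real.sin (θ s) := by
    simp [polarPoint, Complex.exp_ofReal_mul_I_im]
  constructor
  · rw [radialVelocity, hn, hre, him, pre, pim, div_eq_iff hpos.ne']
    linear_combination (ρ s * ρ') * h1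
  · rw [angularVelocity, hn, hre, him, pre, pim, div_eq_iff (by positivity)]
    linear_combination (ρ s ^ 2 * θ') * h1

end PlanarPotential

end

/-!
Near each time `u₀`, a polynomially bounded `z`-harmonic potential is
`V(z, u) = Re (∑ aₘ(u) zᵐ)`, a sum over `m ≤ N` (Borel–Carathéodory and Cauchy estimates,
`exists_eq_re_sum_of_harmonic`). The coefficients are `C¹` functions of `u`, because they are finite
combinations of values of `V(·, u)` at roots of unity (`exists_contDiff_coeff`).

Let the degree be `n ≥ 3` and rotate the plane so that `aₙ(u₀) = -c < 0`. With `ρ` the radius and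
`L` the angular momentum, consider the scaled energy `E = (L² / (2 ρ²) + V) / ρⁿ`. Along a
trajectory the terms linear in `L` cancel in `E'`, the leading part of `V / ρⁿ` does not depend on
`ρ`, and what is left is a damping term of the sign of `-ρ'`, an error `O(ρ' / ρ²)` from the lower
order terms and an error `O(1)` from the time dependence (`hasDerivWithinAt_scaledEnergy`). As
long as `ρ' ≥ 0`, `E` thus increases at most by `O(1 / ρ(u₀) + (s - u₀))`, which is small for large
radii and short times. As `E ≥ V / ρⁿ ≈ -c cos nθ`, with equality at a start with `θ' = 0`, the angle
cannot leave a slightly larger sector. Inside that sector `ρ'' ≥ c₁ ρⁿ⁻¹ ≥ c₁ ρ² > 0`, so that `ρ'`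
stays positive and the argument closes up by continuous induction (`mem_openSector_of_forall_lt`).
The inequality `ρ'' ≥ c₁ ρ²` forces blow-up within a time that tends to `0` as the initial radius
grows (`blowup_of_quadratic_acceleration`, `exists_sector_blowup`), so it happens before the
potential has changed noticeably.

For the completeness criterion, a potential that is not quadratic has near some time a locally
maximal degree `n ≥ 3`, attained at that time (`exists_leading_coeff`). A trajectory that starts
there far out along a direction of steepest decrease exists by Picard–Lindelöf, extends to an
inextensible one by Zorn's lemma (`exists_inextensible`), and blows up. Conversely, for a quadratic potential the
equation of motion is linear, so local solutions exist on intervals of a length that is locally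
uniform in time and independent of the initial values; an inextensible trajectory therefore has no
finite end point (`complete_of_atMostQuadratic`).
-/

namespace PlanarPotential

/-! ### Polynomial form of polynomially bounded harmonic functions -/

theorem evalPoly_le (q : MvPolynomial (Fin 2) ℝ) {N : ℕ} (hq : q.totalDegree ≤ N) :
    ∃ C : ℝ, 0 ≤ C ∧ ∀ z : ℂ, evalPoly q z ≤ C * (1 + ‖z‖) ^ N := by
  refine ⟨∑ d ∈ q.support, |q.coeff d|, Finset.sum_nonneg fun _ _ => abs_nonneg _, fun z => ?_⟩
  rw [evalPoly, MvPolynomial.eval_eq', Finset.sum_mul]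
  refine Finset.sum_le_sum fun d hd => (le_abs_self _).trans ?_
  rw [abs_mul]
  refine mul_le_mul_of_nonneg_left ?_ (abs_nonneg _)
  have h1 : (1 : ℝ) ≤ 1 + ‖z‖ := by linarith [norm_nonneg z]
  have hdeg : d 0 + d 1 ≤ N := by
    refine le_trans ?_ ((MvPolynomial.le_totalDegree hd).trans hq)
    rw [Finsupp.sum_fintype _ _ (fun _ => rfl), Fin.sum_univ_two]
  simp only [Fin.prod_univ_two, Matrix.cons_val_zero, Matrix.cons_val_one, abs_mul, abs_pow]
  calc |z.re| ^ d 0 * |z.im| ^ d 1 ≤ (1 + ‖z‖) ^ d 0 * (1 + ‖z‖) ^ d 1 := by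
        gcongr
        · linarith [Complex.abs_re_le_norm z]
        · linarith [Complex.abs_im_le_norm z]
    _ = (1 + ‖z‖) ^ (d 0 + d 1) := (pow_add _ _ _).symm
    _ ≤ (1 + ‖z‖) ^ N := pow_le_pow_right₀ h1 hdeg

/-- Liouville's theorem with a one-sided polynomial bound: an entire function whose real part is
bounded above by a polynomial in `‖z‖` is itself a polynomial. -/
theorem exists_eq_sum_of_re_le {f : ℂ → ℂ} (hf : Differentiable ℂ f) {C : ℝ} {N : ℕ}
    (hC : ∀ z, (f z).re ≤ C * (1 + ‖z‖) ^ N) :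
    ∃ a : ℕ → ℂ, ∀ z, f z = ∑ m ∈ Finset.range (N + 1), a m * z ^ m := by
  have hzero : ∀ m, N < m → iteratedDeriv m f 0 = 0 := by
    intro m hm
    set D : ℝ := |C| + 1
    have hD : 0 < D := by positivity
    -- Borel–Carathéodory on the disc of radius `2R` controls `f` on the circle of radius `R`.
    have key : ∀ R : ℝ, 1 ≤ R →
        ‖iteratedDeriv m f 0‖ ≤ m.factorial * (2 * D * 3 ^ N + 3 * ‖f 0‖) / R := by
      intro R hR
      have hR0 : 0 < R := by linarith
      have hb : ∀ z ∈ Metric.sphere (0 : ℂ) R, ‖f z‖ ≤ (2 * D * 3 ^ N + 3 * ‖f 0‖) * R ^ N := by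
        intro z hz
        have hz' : ‖z‖ = R := by simpa using hz
        have := Complex.borelCaratheodory (f := f) (M := D * (1 + 2 * R) ^ N) (R := 2 * R) (z := z)
          (by positivity) hf.differentiableOn ?_ (by linarith) (by simp [hz']; linarith)
        · rw [hz'] at this
          have e1 : 2 * (D * (1 + 2 * R) ^ N) * R / (2 * R - R) = 2 * D * (1 + 2 * R) ^ N := by
            field_simp; ring
          have e2 : ‖f 0‖ * (2 * R + R) / (2 * R - R) = 3 * ‖f 0‖ := by
            field_simp; ring
          rw [e1, e2] at this
          have h3 : (1 + 2 * R) ^ N ≤ (3 * R) ^ N := by gcongr; linarith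
          have h4 : 1 ≤ R ^ N := one_le_pow₀ hR
          rw [mul_pow] at h3
          have h5 : 2 * D * (1 + 2 * R) ^ N ≤ 2 * D * (3 ^ N * R ^ N) := by gcongr
          nlinarith [norm_nonneg (f 0)]
        · intro w hw
          have hw' : ‖w‖ ≤ 2 * R := by simpa using (Metric.mem_ball.1 hw).le
          refine (hC w).trans ?_
          have h1 : C ≤ D := by linarith [le_abs_self C]
          gcongr
      have := Complex.norm_iteratedDeriv_le_of_forall_mem_sphere_norm_le m hR0
        (hf.diffContOnCl (s := Metric.ball 0 R)) hb
      refine this.trans ?_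
      have hRm : R ^ N * R ≤ R ^ m := by
        rw [← pow_succ]; exact pow_le_pow_right₀ hR hm
      rw [div_le_div_iff₀ (by positivity) hR0]
      have : (0 : ℝ) ≤ m.factorial * (2 * D * 3 ^ N + 3 * ‖f 0‖) := by positivity
      calc (m.factorial : ℝ) * ((2 * D * 3 ^ N + 3 * ‖f 0‖) * R ^ N) * R
          = m.factorial * (2 * D * 3 ^ N + 3 * ‖f 0‖) * (R ^ N * R) := by ring
        _ ≤ _ := by gcongr
    have hlim : Filter.Tendsto
        (fun R : ℝ => m.factorial * (2 * D * 3 ^ N + 3 * ‖f 0‖) / R) Filter.atTop (nhds 0) :=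
      Filter.Tendsto.const_div_atTop Filter.tendsto_id _
    have := ge_of_tendsto hlim ((Filter.eventually_ge_atTop 1).mono key)
    exact norm_le_zero_iff.1 this
  refine ⟨fun m => (m.factorial : ℂ)⁻¹ * iteratedDeriv m f 0, fun z => ?_⟩
  rw [← Complex.taylorSeries_eq_of_entire' 0 z hf, tsum_eq_sum (s := Finset.range (N + 1))]
  · simp
  · intro m hm
    rw [hzero m (by simpa using hm)]
    simp

theorem exists_eq_re_sum_of_harmonic {h : ℂ → ℝ} (hh : InnerProductSpace.HarmonicOnNhd h univ)
    {q : MvPolynomial (Fin 2) ℝ} {N : ℕ} (hq : q.totalDegree ≤ N) (hle : ∀ z, h z ≤ evalPoly q z) :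
    ∃ a : ℕ → ℂ, ∀ z, h z = (∑ m ∈ Finset.range (N + 1), a m * z ^ m).re := by
  obtain ⟨F, hF, hFh⟩ := hh.exists_analyticOnNhd_univ_re_eq
  obtain ⟨C, -, hC⟩ := evalPoly_le q hq
  obtain ⟨a, ha⟩ := exists_eq_sum_of_re_le (f := F) (fun z => (hF z (mem_univ z)).differentiableAt)
    (fun z => by rw [show (F z).re = h z from congrFun hFh z]; exact (hle z).trans (hC z))
  exact ⟨a, fun z => by rw [← ha, ← hFh]⟩

/-! ### Coefficients of the potential and their regularity -/

/-- The discrete Fourier coefficient of order `l` of a function on the unit circle, sampled at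
the `M`-th roots of unity and doubled. -/
noncomputable def sampledCoeff (M l : ℕ) (h : ℂ → ℝ) : ℂ :=
  2 / M * ∑ j ∈ Finset.range M,
    (h (Complex.exp (2 * Real.pi * Complex.I / M) ^ j) : ℂ) *
      Complex.exp (-(2 * Real.pi * Complex.I / M)) ^ (j * l)

theorem sum_pow_rootOfUnity {M : ℕ} {ζ : ℂ} (hζ : IsPrimitiveRoot ζ M) (e : ℕ) :
    ∑ j ∈ Finset.range M, ζ ^ (j * e) = if M ∣ e then (M : ℂ) else 0 := by
  simp_rw [mul_comm _ e, pow_mul]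
  split_ifs with h
  · simp [(hζ.pow_eq_one_iff_dvd e).2 h]
  · have h1 : ζ ^ e ≠ 1 := fun h' => h ((hζ.pow_eq_one_iff_dvd e).1 h')
    have := geom_sum_eq h1 M
    rw [this, ← pow_mul, mul_comm e M, pow_mul, hζ.pow_eq_one]
    simp

/-- Sampling at `2 N + 1` points recovers the coefficients of positive order of the real part of a
polynomial of degree at most `N`: the frequencies `-N, …, N` are distinct modulo `2 N + 1`. -/
theorem sampledCoeff_eq {N l : ℕ} (hl : 1 ≤ l) (hlN : l ≤ N) (a : ℕ → ℂ) {h : ℂ → ℝ}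
    (hh : ∀ z : ℂ, z ≠ 0 → h z = (∑ m ∈ Finset.range (N + 1), a m * z ^ m).re) :
    sampledCoeff (2 * N + 1) l h = a l := by
  set M := 2 * N + 1 with hM
  have hM0 : M ≠ 0 := by omega
  have hMc : (M : ℂ) ≠ 0 := by exact_mod_cast hM0
  set ζ := Complex.exp (2 * Real.pi * Complex.I / M) with hζdef
  have hζ : IsPrimitiveRoot ζ M := Complex.isPrimitiveRoot_exp M hM0
  have hinv : Complex.exp (-(2 * Real.pi * Complex.I / M)) = ζ⁻¹ := Complex.exp_neg _
  have hζ0 : ζ ≠ 0 := Complex.exp_ne_zero _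
  have hconj : (starRingEnd ℂ) ζ = ζ⁻¹ := by
    rw [hζdef, ← Complex.exp_conj, ← Complex.exp_neg]
    congr 1
    simp [neg_div, Complex.conj_ofNat]
  have hζ' : IsPrimitiveRoot ζ⁻¹ M := hζ.inv
  have hterm : ∀ j, (h (ζ ^ j) : ℂ) * ζ⁻¹ ^ (j * l) =
      ∑ m ∈ Finset.range (N + 1), (a m / 2 * (ζ ^ (j * m) * ζ⁻¹ ^ (j * l)) +
        (starRingEnd ℂ) (a m) / 2 * ζ⁻¹ ^ (j * (m + l))) := by
    intro j
    rw [hh _ (pow_ne_zero _ hζ0), Complex.re_eq_add_conj, map_sum, ← Finset.sum_add_distrib,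
      Finset.sum_div, Finset.sum_mul]
    refine Finset.sum_congr rfl fun m _ => ?_
    rw [map_mul, map_pow, map_pow, hconj, mul_add, pow_add, ← pow_mul, ← pow_mul]
    ring
  rw [sampledCoeff, hinv, Finset.sum_congr rfl fun j _ => hterm j, Finset.sum_comm]
  have hinner : ∀ m ∈ Finset.range (N + 1), ∑ j ∈ Finset.range M,
      (a m / 2 * (ζ ^ (j * m) * ζ⁻¹ ^ (j * l)) +
        (starRingEnd ℂ) (a m) / 2 * ζ⁻¹ ^ (j * (m + l))) = if m = l then a m / 2 * M else 0 := by
    intro m hm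
    have hm : m ≤ N := by simpa [Nat.lt_succ_iff] using hm
    rw [Finset.sum_add_distrib, ← Finset.mul_sum, ← Finset.mul_sum, sum_pow_rootOfUnity hζ',
      if_neg (fun h => by have := Nat.le_of_dvd (by omega) h; omega), mul_zero, add_zero]
    rcases le_total l m with hlm | hlm
    · have : ∀ j, ζ ^ (j * m) * ζ⁻¹ ^ (j * l) = ζ ^ (j * (m - l)) := by
        intro j
        obtain ⟨d, rfl⟩ := Nat.exists_eq_add_of_le hlm
        rw [inv_pow, mul_add, pow_add, Nat.add_sub_cancel_left, mul_right_comm,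
          mul_inv_cancel₀ (pow_ne_zero _ hζ0), one_mul]
      simp_rw [this]
      rw [sum_pow_rootOfUnity hζ]
      by_cases hml : m = l
      · simp [hml]
      · rw [if_neg (fun h => by have := Nat.le_of_dvd (by omega) h; omega), if_neg hml, mul_zero]
    · have : ∀ j, ζ ^ (j * m) * ζ⁻¹ ^ (j * l) = ζ⁻¹ ^ (j * (l - m)) := by
        intro j
        obtain ⟨d, rfl⟩ := Nat.exists_eq_add_of_le hlm
        rw [inv_pow, inv_pow, mul_add, pow_add, Nat.add_sub_cancel_left, mul_inv, ← mul_assoc,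
          mul_inv_cancel₀ (pow_ne_zero _ hζ0), one_mul]
      simp_rw [this]
      rw [sum_pow_rootOfUnity hζ']
      by_cases hml : m = l
      · simp [hml]
      · rw [if_neg (fun h => by have := Nat.le_of_dvd (by omega) h; omega), if_neg hml, mul_zero]
  rw [Finset.sum_congr rfl hinner, Finset.sum_ite_eq' , if_pos (by simp; omega)]
  field_simp

/-- If `V(·, u)` is the real part of a polynomial of degree at most `N` for each `u ∈ I`, the
coefficients can be chosen to be `C¹` on all of `ℝ`, since they are linear combinations of
finitely many values of `V(·, u)`. -/
theorem exists_contDiff_coeff {V : ℂ → ℝ → ℝ} (hV : ContDiff ℝ 1 (fun p : ℂ × ℝ => V p.1 p.2))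
    {I : Set ℝ} {N : ℕ}
    (hI : ∀ u ∈ I, ∃ b : ℕ → ℂ, ∀ z, z ≠ 0 →
      V z u = (∑ m ∈ Finset.range (N + 1), b m * z ^ m).re) :
    ∃ a : ℕ → ℝ → ℂ, (∀ m, ContDiff ℝ 1 (a m)) ∧
      ∀ u ∈ I, ∀ z, V z u = (∑ m ∈ Finset.range (N + 1), a m u * z ^ m).re := by
  have hVz : ∀ z, ContDiff ℝ 1 (fun u => V z u) := fun z => by
    exact hV.comp (f := fun u : ℝ => (z, u)) (by fun_prop)
  refine ⟨fun m u => if m = 0 then (V 0 u : ℂ) else sampledCoeff (2 * N + 1) m (fun z => V z u),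
    fun m => ?_, fun u hu z => ?_⟩
  · by_cases hm : m = 0
    · simpa [hm] using! Complex.ofRealCLM.contDiff.comp (hVz 0)
    · simp only [hm, if_false, sampledCoeff]
      refine contDiff_const.mul (ContDiff.sum fun j _ => ContDiff.mul ?_ contDiff_const)
      exact Complex.ofRealCLM.contDiff.comp (hVz _)
  · obtain ⟨b, hb⟩ := hI u hu
    -- The identity extends to the origin by continuity.
    have hc1 : Continuous (fun z => V z u) := by
      exact hV.continuous.comp (f := fun z : ℂ => (z, u)) (by fun_prop)
    have hall : (fun z => V z u) = fun z => (∑ m ∈ Finset.range (N + 1), b m * z ^ m).re :=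
      hc1.ext_on (dense_compl_singleton (0 : ℂ)) (by fun_prop) (fun z hz => hb z hz)
    have hall' : ∀ z, V z u = (∑ m ∈ Finset.range (N + 1), b m * z ^ m).re := congrFun hall
    have h0 : V 0 u = (b 0).re := by
      rw [hall' 0, Finset.sum_range_succ']; simp
    rw [hall' z, Finset.sum_range_succ', Finset.sum_range_succ', add_re, add_re]
    congr 1
    · congr 1
      refine Finset.sum_congr rfl fun m hm => ?_
      dsimp only
      rw [if_neg (by omega), sampledCoeff_eq (a := b) (by omega) (by simp at hm; omega) hb]
    · simp [h0]

theorem coeff_unique {N : ℕ} {a b : ℕ → ℂ}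
    (h : ∀ z : ℂ, z ≠ 0 → (∑ m ∈ Finset.range (N + 1), a m * z ^ m).re =
      (∑ m ∈ Finset.range (N + 1), b m * z ^ m).re) {l : ℕ} (hl : 1 ≤ l) (hlN : l ≤ N) :
    a l = b l := by
  rw [← sampledCoeff_eq hl hlN a (h := fun z => (∑ m ∈ Finset.range (N + 1), a m * z ^ m).re)
    (fun _ _ => rfl), sampledCoeff_eq hl hlN b h]

/-- The gradient of the real part of a polynomial is the conjugate of its complex derivative. -/
theorem gradient_re_sum (a : ℕ → ℂ) (N : ℕ) (z : ℂ) :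
    gradient (fun z : ℂ => (∑ m ∈ Finset.range (N + 1), a m * z ^ m).re) z =
      (starRingEnd ℂ) (∑ m ∈ Finset.range (N + 1), m * a m * z ^ (m - 1)) := by
  apply HasGradientAt.gradient
  rw [hasGradientAt_iff_hasFDerivAt]
  have h1 : HasDerivAt (fun z : ℂ => ∑ m ∈ Finset.range (N + 1), a m * z ^ m)
      (∑ m ∈ Finset.range (N + 1), m * a m * z ^ (m - 1)) z := by
    refine HasDerivAt.fun_sum fun m _ => ?_
    convert! (hasDerivAt_pow m z).const_mul (a m) using 1
    ring
  have h2 := Complex.reCLM.hasFDerivAt.comp z (h1.hasFDerivAt.restrictScalars ℝ)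
  convert! h2 using 1
  generalize (∑ m ∈ Finset.range (N + 1), (m : ℂ) * a m * z ^ (m - 1)) = S
  ext w
  simp [Complex.inner]

/-! ### Continuous induction and blow-up of a scalar inequality -/

/-- Continuous induction: a curve that cannot be outside the open set `Ω` for the first time at any
positive time stays in `Ω`. -/
theorem forall_mem_of_isOpen_of_forall_lt {X : Type*} [TopologicalSpace X] {f : ℝ → X} {a b : ℝ}
    {Ω : Set X} (hΩ : IsOpen Ω) (hf : ContinuousOn f (Ico a b)) (ha : f a ∈ Ω)
    (hstep : ∀ t ∈ Ioo a b, (∀ s ∈ Ico a t, f s ∈ Ω) → f t ∈ Ω) :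
    ∀ t ∈ Ico a b, f t ∈ Ω := by
  by_contra! hcon
  obtain ⟨t₁, ht₁, hft₁⟩ := hcon
  -- The first exit time is the least element of the compact set of times outside `Ω`.
  have hcl : IsClosed (Icc a t₁ ∩ f ⁻¹' Ωᶜ) :=
    (hf.mono fun s hs => ⟨hs.1, hs.2.trans_lt ht₁.2⟩).preimage_isClosed_of_isClosed
      isClosed_Icc hΩ.isClosed_compl
  have hcpt : IsCompact (Icc a t₁ ∩ f ⁻¹' Ωᶜ) :=
    isCompact_Icc.of_isClosed_subset hcl inter_subset_left
  obtain ⟨t, ⟨ht, hft⟩, hmin⟩ := hcpt.exists_isLeast ⟨t₁, ⟨ht₁.1, le_rfl⟩, hft₁⟩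
  have hat : a < t := lt_of_le_of_ne ht.1 fun h => hft (h ▸ ha)
  refine hft (hstep t ⟨hat, ht.2.trans_lt ht₁.2⟩ fun s hs => ?_)
  by_contra hs'
  exact absurd (hmin ⟨⟨hs.1, hs.2.le.trans ht.2⟩, hs'⟩) (not_le.2 hs.2)

/-- A function with `ρ'' ≥ c ρ²` and nonnegative initial slope that starts above `24 / (c T²)`
cannot live for time `T`: it dominates the explicit subsolution
`24 T² / c * (T² - t²)⁻²`, which has zero initial slope and blows up at time `T`. -/
theorem blowup_of_quadratic_acceleration {ρ r q : ℝ → ℝ} {a T c : ℝ} (hc : 0 < c) (hT : 0 < T)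
    (hρ : ∀ t ∈ Icc a (a + T), HasDerivWithinAt ρ (r t) (Icc a (a + T)) t)
    (hr : ∀ t ∈ Icc a (a + T), HasDerivWithinAt r (q t) (Icc a (a + T)) t)
    (hq : ∀ t ∈ Icc a (a + T), c * ρ t ^ 2 ≤ q t) (hra : 0 ≤ r a)
    (hρa : 24 / (c * T ^ 2) < ρ a) : False := by
  set K : ℝ := 24 * T ^ 2 / c with hK
  have hK0 : 0 < K := by positivity
  set g : ℝ → ℝ := fun t => T ^ 2 - (t - a) ^ 2 with hg
  have hgpos : ∀ t ∈ Ico a (a + T), 0 < g t := by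
    intro t ht
    have h1 : 0 ≤ t - a := by linarith [ht.1]
    have h2 : t - a < T := by linarith [ht.2]
    simp only [hg]
    nlinarith
  have hgd : ∀ t, HasDerivAt g (-(2 * (t - a))) t := by
    intro t
    have := (((hasDerivAt_id t).sub_const a).pow 2).const_sub (T ^ 2)
    refine this.congr_deriv ?_
    simp
  set y : ℝ → ℝ := fun t => K / g t ^ 2 with hy
  set y1 : ℝ → ℝ := fun t => 4 * K * (t - a) / g t ^ 3 with hy1
  set y2 : ℝ → ℝ := fun t => 4 * K / g t ^ 3 + 24 * K * (t - a) ^ 2 / g t ^ 4 with hy2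
  have hyd : ∀ t ∈ Ico a (a + T), HasDerivAt y (y1 t) t := by
    intro t ht
    have hg0 := (hgpos t ht).ne'
    refine ((hasDerivAt_const t K).div ((hgd t).pow 2) (pow_ne_zero _ hg0)).congr_deriv ?_
    simp only [hy1, Pi.pow_apply]
    field_simp
    ring
  have hy1d : ∀ t ∈ Ico a (a + T), HasDerivAt y1 (y2 t) t := by
    intro t ht
    have hg0 := (hgpos t ht).ne'
    refine ((((hasDerivAt_id t).sub_const a).const_mul (4 * K)).div ((hgd t).pow 3)
      (pow_ne_zero _ hg0)).congr_deriv ?_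
    simp only [hy2, id, Pi.pow_apply]
    field_simp
    ring
  have hy2le : ∀ t ∈ Ico a (a + T), y2 t ≤ c * y t ^ 2 := by
    intro t ht
    have hg0 := hgpos t ht
    have h1 : 0 ≤ t - a := by linarith [ht.1]
    have h2 : t - a < T := by linarith [ht.2]
    have e : c * y t ^ 2 - y2 t = K * (24 * T ^ 2 - 4 * g t - 24 * (t - a) ^ 2) / g t ^ 4 := by
      simp only [hy, hy2, hK]
      field_simp
      ring
    have : 0 ≤ c * y t ^ 2 - y2 t := by
      rw [e]
      refine div_nonneg (mul_nonneg hK0.le ?_) (by positivity)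
      simp only [hg]
      nlinarith
    linarith
  have hpos : ∀ t ∈ Ico a (a + T), ρ t - y t ∈ Ioi (0 : ℝ) := by
    have hdd : ∀ t ∈ Ico a (a + T),
        HasDerivWithinAt (fun t => ρ t - y t) (r t - y1 t) (Icc a (a + T)) t := fun t ht =>
      (hρ t ⟨ht.1, ht.2.le⟩).sub (hyd t ht).hasDerivWithinAt
    have hdr : ∀ t ∈ Ico a (a + T),
        HasDerivWithinAt (fun t => r t - y1 t) (q t - y2 t) (Icc a (a + T)) t := fun t ht =>
      (hr t ⟨ht.1, ht.2.le⟩).sub (hy1d t ht).hasDerivWithinAt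
    refine forall_mem_of_isOpen_of_forall_lt isOpen_Ioi ?_ ?_ ?_
    · exact fun t ht => ((hdd t ht).mono Ico_subset_Icc_self).continuousWithinAt
    · have : y a = 24 / (c * T ^ 2) := by
        simp only [hy, hg, hK]
        field_simp
        ring
      rw [mem_Ioi, this]
      linarith
    · intro t ht hs
      have hsub : Icc a t ⊆ Ico a (a + T) := fun s hs => ⟨hs.1, hs.2.trans_lt ht.2⟩
      have hsub' : Icc a t ⊆ Icc a (a + T) := hsub.trans Ico_subset_Icc_self
      have hmono1 : MonotoneOn (fun t => r t - y1 t) (Icc a t) := by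
        refine monotoneOn_of_hasDerivWithinAt_nonneg (f' := fun t => q t - y2 t) (convex_Icc a t)
          (fun s hs => ((hdr s (hsub hs)).mono hsub').continuousWithinAt) ?_ ?_
        · intro s hs
          exact (hdr s (hsub (interior_subset hs))).mono (interior_subset.trans hsub')
        · intro s hs'
          rw [interior_Icc] at hs'
          have h1 : 0 < ρ s - y s := hs s ⟨hs'.1.le, hs'.2⟩
          have hsI : s ∈ Ico a (a + T) := hsub ⟨hs'.1.le, hs'.2.le⟩
          have h2 := hq s ⟨hsI.1, hsI.2.le⟩
          have h3 := hy2le s hsI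
          have h4 : 0 ≤ y s := by have := hgpos s hsI; positivity
          have h5 : y s ^ 2 ≤ ρ s ^ 2 := by gcongr; linarith
          have h6 := mul_le_mul_of_nonneg_left h5 hc.le
          linarith
      have hmono : MonotoneOn (fun t => ρ t - y t) (Icc a t) := by
        refine monotoneOn_of_hasDerivWithinAt_nonneg (f' := fun t => r t - y1 t) (convex_Icc a t)
          (fun s hs => ((hdd s (hsub hs)).mono hsub').continuousWithinAt) ?_ ?_
        · intro s hs
          exact (hdd s (hsub (interior_subset hs))).mono (interior_subset.trans hsub')
        · intro s hs'
          have hsI := interior_subset hs'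
          have h1 := hmono1 (left_mem_Icc.2 ht.1.le) hsI hsI.1
          have h2 : y1 a = 0 := by simp [hy1]
          simp only [h2] at h1
          linarith
      have h1 := hmono (left_mem_Icc.2 ht.1.le) (right_mem_Icc.2 ht.1.le) ht.1.le
      have h2 : 0 < ρ a - y a := hs a ⟨le_rfl, ht.1⟩
      exact mem_Ioi.2 (h2.trans_le h1)
  -- Cleared of denominators, the comparison persists at the end point, where it reads `K ≤ 0`.
  have hcont : ContinuousOn (fun t => g t ^ 2 * ρ t) (Icc a (a + T)) := fun t ht =>
    (((hgd t).continuousAt.pow 2).continuousWithinAt).mul (hρ t ht).continuousWithinAt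
  have hmem : a + T ∈ closure (Ico a (a + T)) := by
    rw [closure_Ico (by linarith)]; exact ⟨by linarith, le_rfl⟩
  have hle : K ≤ g (a + T) ^ 2 * ρ (a + T) := by
    refine ContinuousWithinAt.closure_le hmem (f := fun _ => K) (g := fun t => g t ^ 2 * ρ t)
      continuousWithinAt_const
      ((hcont _ ⟨by linarith, le_rfl⟩).mono Ico_subset_Icc_self) ?_
    intro t ht
    have h1 : 0 < ρ t - K / g t ^ 2 := hpos t ht
    have h2 := hgpos t ht
    have h3 : K / g t ^ 2 < ρ t := by linarith
    rw [div_lt_iff₀ (by positivity)] at h3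
    linarith
  simp only [hg, add_sub_cancel_left, sub_self] at hle
  linarith [hle, show (0 : ℝ) ^ 2 * ρ (a + T) = 0 by simp]

/-! ### Leading and lower order terms of a polynomial -/

/-- Outside the unit disc, the terms of order `< n` contribute one power of the radius less than
the leading term. -/
theorem norm_sum_lower_le {n : ℕ} {b : ℕ → ℂ} {B : ℝ} (hb : ∀ m < n, ‖b m‖ ≤ B) {z : ℂ}
    (hz : 1 ≤ ‖z‖) :
    ‖∑ m ∈ Finset.range n, b m * z ^ m‖ * ‖z‖ ≤ n * B * ‖z‖ ^ n := by
  have : ‖∑ m ∈ Finset.range n, b m * z ^ m‖ ≤ n * (B * ‖z‖ ^ (n - 1)) := by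
    refine (norm_sum_le _ _).trans ((Finset.sum_le_card_nsmul _ _ (B * ‖z‖ ^ (n - 1))
      fun m hm => ?_).trans (by simp))
    have hm : m < n := Finset.mem_range.1 hm
    rw [norm_mul, norm_pow]
    have h1 := hb m hm
    have h0 : 0 ≤ B := (norm_nonneg _).trans h1
    gcongr
    omega
  rcases Nat.eq_zero_or_pos n with rfl | hn
  · simp
  · calc _ ≤ n * (B * ‖z‖ ^ (n - 1)) * ‖z‖ := by gcongr
      _ = n * B * (‖z‖ ^ (n - 1) * ‖z‖) := by ring
      _ = _ := by rw [← pow_succ, Nat.sub_add_cancel hn]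

theorem re_pow_eq (z : ℂ) (n : ℕ) : (z ^ n).re = ‖z‖ ^ n * Real.cos (n * arg z) := by
  conv_lhs => rw [← Complex.norm_mul_exp_arg_mul_I z, mul_pow, ← Complex.exp_nat_mul]
  rw [← ofReal_pow, re_ofReal_mul, show (n : ℂ) * (arg z * I) = ((n * arg z : ℝ) : ℂ) * I by
    push_cast; ring, exp_ofReal_mul_I_re]

/-- At a fixed time, the value of `Re (∑ aₘ zᵐ)` is `-c ‖z‖ⁿ cos (n arg z)` up to the lower order
terms and the deviation of the leading coefficient from `-c`. -/
theorem abs_re_sum_add_le {n : ℕ} {b : ℕ → ℂ} {c C η : ℝ} (hb : ∀ m ≤ n, n * ‖b m‖ ≤ C)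
    (hbn : ‖b n + c‖ ≤ η) {z : ℂ} (hz : 1 ≤ ‖z‖) :
    |(∑ m ∈ Finset.range (n + 1), b m * z ^ m).re + c * ‖z‖ ^ n * Real.cos (n * arg z)| ≤
      (C / ‖z‖ + η) * ‖z‖ ^ n := by
  have hz0 : 0 < ‖z‖ := by linarith
  have e : (∑ m ∈ Finset.range (n + 1), b m * z ^ m).re + c * ‖z‖ ^ n * Real.cos (n * arg z) =
      (∑ m ∈ Finset.range n, b m * z ^ m + (b n + c) * z ^ n).re := by
    rw [Finset.sum_range_succ, mul_assoc, ← re_pow_eq, ← re_ofReal_mul, ← add_re]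
    congr 1
    ring
  rw [e]
  refine (Complex.abs_re_le_norm _).trans ((norm_add_le _ _).trans ?_)
  rw [norm_mul, norm_pow, add_mul]
  refine add_le_add ?_ (by gcongr)
  rw [div_mul_eq_mul_div, le_div_iff₀ hz0]
  rcases Nat.eq_zero_or_pos n with rfl | hn
  · have := hb 0 le_rfl
    simp at this
    simpa using this
  · have hn' : (0 : ℝ) < n := by exact_mod_cast hn
    refine (norm_sum_lower_le (B := C / n) (fun m hm => ?_) hz).trans (le_of_eq (by field_simp))
    rw [le_div_iff₀ hn', mul_comm]
    exact hb m hm.le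

/-- Euler's relation up to lower order: the radial derivative of a polynomial of degree `n` is
`n` times its value, except for the lower order terms. -/
theorem norm_euler_sub_le {n : ℕ} {b : ℕ → ℂ} {C : ℝ} (hb : ∀ m ≤ n, n * (n * ‖b m‖) ≤ C)
    {z : ℂ} (hz : 1 ≤ ‖z‖) :
    ‖∑ m ∈ Finset.range (n + 1), m * b m * z ^ m - n * ∑ m ∈ Finset.range (n + 1), b m * z ^ m‖ *
      ‖z‖ ≤ C * ‖z‖ ^ n := by
  have e : ∑ m ∈ Finset.range (n + 1), m * b m * z ^ m
      - n * ∑ m ∈ Finset.range (n + 1), b m * z ^ m =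
      ∑ m ∈ Finset.range n, ((m : ℂ) - n) * b m * z ^ m := by
    rw [Finset.mul_sum, ← Finset.sum_sub_distrib, Finset.sum_range_succ]
    rw [show (n : ℂ) * b n * z ^ n - n * (b n * z ^ n) = 0 by ring, add_zero]
    exact Finset.sum_congr rfl fun m _ => by ring
  rw [e]
  rcases Nat.eq_zero_or_pos n with rfl | hn
  · have := hb 0 le_rfl
    simp at this
    simpa using this
  · have hn' : (0 : ℝ) < n := by exact_mod_cast hn
    refine (norm_sum_lower_le (B := C / n) (fun m hm => ?_) hz).trans (le_of_eq (by field_simp))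
    rw [le_div_iff₀ hn', mul_comm, norm_mul]
    refine le_trans ?_ (hb m hm.le)
    have : ‖(m : ℂ) - n‖ ≤ n := by
      rw [← norm_neg, neg_sub, ← Nat.cast_sub hm.le, Complex.norm_natCast]
      exact_mod_cast Nat.sub_le n m
    gcongr

theorem norm_sum_le_pow {n : ℕ} {b : ℕ → ℂ} {C : ℝ} (hb : ∀ m ≤ n, (n + 1) * ‖b m‖ ≤ C) {z : ℂ}
    (hz : 1 ≤ ‖z‖) : ‖∑ m ∈ Finset.range (n + 1), b m * z ^ m‖ ≤ C * ‖z‖ ^ n := by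
  have hn' : (0 : ℝ) < n + 1 := by positivity
  refine (norm_sum_le _ _).trans ((Finset.sum_le_card_nsmul _ _ (C / (n + 1) * ‖z‖ ^ n)
    fun m hm => ?_).trans ?_)
  · have hm : m ≤ n := Nat.lt_succ_iff.1 (Finset.mem_range.1 hm)
    rw [norm_mul, norm_pow]
    have h1 : ‖b m‖ ≤ C / (n + 1) := by rw [le_div_iff₀ hn', mul_comm]; exact hb m hm
    have h0 : 0 ≤ C / (n + 1) := (norm_nonneg _).trans h1
    gcongr
  · rw [Finset.card_range, nsmul_eq_mul]
    push_cast
    exact le_of_eq (by field_simp)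

/-! ### Polar components of a plane curve -/

/-- The angular momentum `x y' - y x'` of the velocity `v` at the point `z`. -/
def angularMomentum (z v : ℂ) : ℝ := z.re * v.im - z.im * v.re

section

variable {J : Set ℝ} {w v : ℝ → ℂ} {s : ℝ} {F : ℂ}

theorem hasDerivWithinAt_re {d : ℂ} (h : HasDerivWithinAt w d J s) :
    HasDerivWithinAt (fun t => (w t).re) d.re J s :=
  Complex.reCLM.hasFDerivAt.comp_hasDerivWithinAt s h

theorem hasDerivWithinAt_im {d : ℂ} (h : HasDerivWithinAt w d J s) :
    HasDerivWithinAt (fun t => (w t).im) d.im J s :=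
  Complex.imCLM.hasFDerivAt.comp_hasDerivWithinAt s h

theorem norm_sq_eq (z : ℂ) : ‖z‖ ^ 2 = z.re ^ 2 + z.im ^ 2 := by
  rw [Complex.sq_norm, normSq_apply]; ring

theorem hasDerivWithinAt_norm (hw : HasDerivWithinAt w (v s) J s) (h0 : w s ≠ 0) :
    HasDerivWithinAt (fun t => ‖w t‖) (radialVelocity (w s) (v s)) J s := by
  have hpos : 0 < ‖w s‖ := norm_pos_iff.2 h0
  have h := ((hasDerivWithinAt_re hw).pow 2).add ((hasDerivWithinAt_im hw).pow 2)
  have h' : HasDerivWithinAt (fun t => ‖w t‖ ^ 2)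
      (2 * (w s).re * (v s).re + 2 * (w s).im * (v s).im) J s := by
    simp_rw [norm_sq_eq]
    convert! h using 1
    simp
  have h2 := h'.sqrt (pow_pos hpos 2).ne'
  simp only [Real.sqrt_sq (norm_nonneg _)] at h2
  refine h2.congr_deriv ?_
  rw [radialVelocity]
  field_simp

theorem hasDerivWithinAt_radialVelocity (hw : HasDerivWithinAt w (v s) J s)
    (hv : HasDerivWithinAt v F J s) (h0 : w s ≠ 0) :
    HasDerivWithinAt (fun t => radialVelocity (w t) (v t))
      (angularMomentum (w s) (v s) ^ 2 / ‖w s‖ ^ 3 +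
        ((w s).re * F.re + (w s).im * F.im) / ‖w s‖) J s := by
  have hpos : 0 < ‖w s‖ := norm_pos_iff.2 h0
  have h := (((hasDerivWithinAt_re hw).mul (hasDerivWithinAt_re hv)).add
    ((hasDerivWithinAt_im hw).mul (hasDerivWithinAt_im hv))).div
      (hasDerivWithinAt_norm hw h0) hpos.ne'
  refine h.congr_deriv ?_
  have e := norm_sq_eq (w s)
  simp only [radialVelocity, angularMomentum, Pi.add_apply, Pi.mul_apply]
  field_simp
  rw [e]
  ring

theorem hasDerivWithinAt_angularMomentum (hw : HasDerivWithinAt w (v s) J s)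
    (hv : HasDerivWithinAt v F J s) :
    HasDerivWithinAt (fun t => angularMomentum (w t) (v t))
      ((w s).re * F.im - (w s).im * F.re) J s := by
  have h := ((hasDerivWithinAt_re hw).mul (hasDerivWithinAt_im hv)).sub
    ((hasDerivWithinAt_im hw).mul (hasDerivWithinAt_re hv))
  refine h.congr_deriv ?_
  ring

theorem hasDerivWithinAt_sum {a ad : ℕ → ℝ → ℂ} {n : ℕ}
    (ha : ∀ m, HasDerivAt (a m) (ad m s) s) (hw : HasDerivWithinAt w (v s) J s) :
    HasDerivWithinAt (fun t => (∑ m ∈ Finset.range (n + 1), a m t * w t ^ m).re)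
      ((∑ m ∈ Finset.range (n + 1), ad m s * w s ^ m).re +
        ((∑ m ∈ Finset.range (n + 1), m * a m s * w s ^ (m - 1)) * v s).re) J s := by
  have h : HasDerivWithinAt (fun t => ∑ m ∈ Finset.range (n + 1), a m t * w t ^ m)
      (∑ m ∈ Finset.range (n + 1), (ad m s * w s ^ m + a m s * (m * w s ^ (m - 1) * v s))) J s :=
    HasDerivWithinAt.fun_sum fun m _ => (ha m).hasDerivWithinAt.mul (hw.pow m)
  refine (hasDerivWithinAt_re h).congr_deriv ?_
  rw [← add_re, Finset.sum_mul, ← Finset.sum_add_distrib]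
  congr 1
  exact Finset.sum_congr rfl fun m _ => by ring

end

/-! ### Force and scaled energy -/

/-- The force `-∇ Re (∑ aₘ zᵐ)` of the potential with coefficients `b` at the point `z`. -/
def force (n : ℕ) (b : ℕ → ℂ) (z : ℂ) : ℂ :=
  -(starRingEnd ℂ) (∑ m ∈ Finset.range (n + 1), m * b m * z ^ (m - 1))

theorem mul_sum_deriv (n : ℕ) (b : ℕ → ℂ) (z : ℂ) :
    z * ∑ m ∈ Finset.range (n + 1), m * b m * z ^ (m - 1) =
      ∑ m ∈ Finset.range (n + 1), m * b m * z ^ m := by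
  rw [Finset.mul_sum]
  refine Finset.sum_congr rfl fun m _ => ?_
  rcases Nat.eq_zero_or_pos m with rfl | hm
  · simp
  · conv_rhs => rw [← Nat.sub_add_cancel hm, pow_succ]
    simp only [Nat.sub_add_cancel hm]
    ring

theorem radial_force (n : ℕ) (b : ℕ → ℂ) (z : ℂ) :
    z.re * (force n b z).re + z.im * (force n b z).im =
      -(∑ m ∈ Finset.range (n + 1), m * b m * z ^ m).re := by
  rw [← mul_sum_deriv, force]
  simp only [neg_re, neg_im, conj_re, conj_im, mul_re]
  ring

/-- The energy that controls the angular motion: kinetic energy of rotation plus potential energy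
`U`, divided by the `n`-th power of the radius. -/
noncomputable def scaledEnergy (n : ℕ) (U : ℝ) (z v : ℂ) : ℝ :=
  (angularMomentum z v ^ 2 / (2 * ‖z‖ ^ 2) + U) / ‖z‖ ^ n

/-- The derivative of the scaled energy along a trajectory. The powers of the angular velocity
appear only in the damping term, so an outward motion can increase the scaled energy only through
the lower order terms and the explicit time dependence of the coefficients. -/
theorem hasDerivWithinAt_scaledEnergy {J : Set ℝ} {w v : ℝ → ℂ} {s : ℝ} {a ad : ℕ → ℝ → ℂ} {n : ℕ}
    (ha : ∀ m, HasDerivAt (a m) (ad m s) s) (hw : HasDerivWithinAt w (v s) J s)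
    (hv : HasDerivWithinAt v (force n (fun m => a m s) (w s)) J s) (h0 : w s ≠ 0) :
    HasDerivWithinAt
      (fun t => scaledEnergy n (∑ m ∈ Finset.range (n + 1), a m t * w t ^ m).re (w t) (v t))
      (((∑ m ∈ Finset.range (n + 1), ad m s * w s ^ m).re +
        radialVelocity (w s) (v s) / ‖w s‖ *
          ((∑ m ∈ Finset.range (n + 1), m * a m s * w s ^ m
            - n * ∑ m ∈ Finset.range (n + 1), a m s * w s ^ m).re
          - (n + 2) * (angularMomentum (w s) (v s) ^ 2 / (2 * ‖w s‖ ^ 2)))) / ‖w s‖ ^ n) J s := by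
  have hpos : 0 < ‖w s‖ := norm_pos_iff.2 h0
  have hρ := hasDerivWithinAt_norm hw h0
  have h := ((((hasDerivWithinAt_angularMomentum hw hv).pow 2).div ((hρ.pow 2).const_mul 2)
    (mul_pos two_pos (pow_pos hpos 2)).ne').add (hasDerivWithinAt_sum (n := n) ha hw)).div
    (hρ.pow n)
    (pow_pos hpos n).ne'
  refine h.congr_deriv ?_
  rw [← mul_sum_deriv]
  simp only [force, sub_re, neg_re, neg_im, conj_re, conj_im, mul_re, natCast_re, natCast_im,
    zero_mul, sub_zero, Pi.pow_apply, Pi.add_apply, Pi.div_apply]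
  generalize (∑ m ∈ Finset.range (n + 1), (m : ℂ) * a m s * w s ^ (m - 1)) = P
  generalize (∑ m ∈ Finset.range (n + 1), a m s * w s ^ m) = S
  generalize (∑ m ∈ Finset.range (n + 1), ad m s * w s ^ m) = Sd
  have e := norm_sq_eq (w s)
  have hn : (n : ℝ) * ‖w s‖ ^ (n - 1) = n * ‖w s‖ ^ n / ‖w s‖ := by
    rcases Nat.eq_zero_or_pos n with rfl | hn
    · simp
    · rw [eq_div_iff hpos.ne', mul_assoc, ← pow_succ, Nat.sub_add_cancel hn]
  rw [hn]
  simp only [radialVelocity, angularMomentum]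
  generalize (w s).re = x at *
  generalize (w s).im = y at *
  generalize ‖w s‖ = ρ at *
  generalize (v s).re = p at *
  generalize (v s).im = q at *
  have hρn : ρ ^ n ≠ 0 := by positivity
  generalize ρ ^ n = R at *
  field_simp
  push_cast
  norm_num
  linear_combination 2 * ρ ^ 3 * (p * P.re - q * P.im) * e

/-! ### Confinement to a sector -/

/-- The open sector of points with radius `> R` and argument at distance `< θ` from `0`. -/
def openSector (R θ : ℝ) : Set ℂ := {z | R < ‖z‖} ∩ {z ∈ slitPlane | |arg z| < θ}

theorem isOpen_openSector (R θ : ℝ) : IsOpen (openSector R θ) := by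
  refine (isOpen_lt continuous_const continuous_norm).inter ?_
  have : ContinuousOn (fun z : ℂ => |arg z|) slitPlane :=
    fun z hz => (continuousAt_arg hz).abs.continuousWithinAt
  exact this.isOpen_inter_preimage isOpen_slitPlane isOpen_Iio

theorem abs_arg_le_of_norm_mul_cos_le {z : ℂ} {θ : ℝ} (h0 : z ≠ 0) (hθ : 0 ≤ θ) (hθ' : θ ≤ Real.pi)
    (h : ‖z‖ * Real.cos θ ≤ z.re) : |arg z| ≤ θ := by
  by_contra! hlt
  have h1 := Real.strictAntiOn_cos ⟨hθ, hθ'⟩ ⟨abs_nonneg _, abs_arg_le_pi z⟩ hlt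
  rw [Real.cos_abs, cos_arg h0, div_lt_iff₀ (norm_pos_iff.2 h0)] at h1
  linarith

theorem norm_mul_cos_le_of_abs_arg_le {z : ℂ} {θ : ℝ} (hθ' : θ ≤ Real.pi) (h : |arg z| ≤ θ) :
    ‖z‖ * Real.cos θ ≤ z.re := by
  rw [← Complex.norm_mul_cos_arg z, ← Real.cos_abs (arg z)]
  exact mul_le_mul_of_nonneg_left (Real.cos_le_cos_of_nonneg_of_le_pi (abs_nonneg _) hθ' h)
    (norm_nonneg z)

/-- In the sector, the radial force grows at least like the `(n - 1)`-st power of the radius. -/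
theorem radial_force_lower {n : ℕ} {b : ℕ → ℂ} {c C η R θ : ℝ} (hn : 1 ≤ n) (hR : 1 ≤ R)
    (hc : 0 < c) (hθ : n * θ < Real.pi / 2)
    (hb : ∀ m ≤ n, (n + 1) ^ 2 * ‖b m‖ ≤ C) (hbn : ‖b n + c‖ ≤ η)
    (hsmall : n * (C / R + η) + C / R ≤ c * Real.cos (n * θ) / 2)
    {z : ℂ} (hz : R ≤ ‖z‖) (harg : |arg z| ≤ θ) :
    c * Real.cos (n * θ) / 2 * ‖z‖ ^ n ≤
      z.re * (force n b z).re + z.im * (force n b z).im := by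
  have hz1 : 1 ≤ ‖z‖ := hR.trans hz
  have hn' : (1 : ℝ) ≤ n := by exact_mod_cast hn
  have hC : 0 ≤ C := le_trans (by positivity) (hb 0 (Nat.zero_le _))
  have h1 := abs_re_sum_add_le (c := c) (C := C) (η := η)
    (fun m hm => le_trans (mul_le_mul_of_nonneg_right (by nlinarith) (norm_nonneg _)) (hb m hm))
    hbn hz1
  have h2 := norm_euler_sub_le (C := C) (fun m hm => le_trans (le_of_eq (mul_assoc _ _ _).symm)
    (le_trans (mul_le_mul_of_nonneg_right (by nlinarith) (norm_nonneg _)) (hb m hm))) hz1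
  rw [← le_div_iff₀ (by linarith)] at h2
  have h3 := (Complex.re_le_norm _).trans h2
  rw [radial_force]
  simp only [sub_re, mul_re, natCast_re, natCast_im, zero_mul, sub_zero] at h3
  have h4 := (abs_le.1 h1).2
  have hcos : Real.cos (n * θ) ≤ Real.cos (n * arg z) := by
    rw [← Real.cos_abs (n * arg z), abs_mul, Nat.abs_cast]
    exact Real.cos_le_cos_of_nonneg_of_le_pi (by positivity) (by linarith [Real.pi_pos])
      (by gcongr)
  have hCR : C / ‖z‖ ≤ C / R := by gcongr
  have hp : 0 ≤ ‖z‖ ^ n := by positivity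
  have hcosp : 0 ≤ Real.cos (n * θ) := by
    refine Real.cos_nonneg_of_neg_pi_div_two_le_of_le ?_ hθ.le
    have : 0 ≤ (n : ℝ) * θ := mul_nonneg (by positivity) ((abs_nonneg _).trans harg)
    linarith [Real.pi_pos]
  have e1 : C * ‖z‖ ^ n / ‖z‖ = C / ‖z‖ * ‖z‖ ^ n := by ring
  rw [e1] at h3
  have h5 : n * ((∑ m ∈ Finset.range (n + 1), b m * z ^ m).re) ≤
      n * ((C / ‖z‖ + η) * ‖z‖ ^ n - c * ‖z‖ ^ n * Real.cos (n * arg z)) := by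
    gcongr; linarith
  have h6 : c * ‖z‖ ^ n * Real.cos (n * θ) ≤ n * (c * ‖z‖ ^ n * Real.cos (n * arg z)) := by
    have : c * ‖z‖ ^ n * Real.cos (n * θ) ≤ c * ‖z‖ ^ n * Real.cos (n * arg z) := by gcongr
    have h0 : 0 ≤ c * ‖z‖ ^ n * Real.cos (n * θ) := by positivity
    nlinarith
  have h7 : (n * (C / ‖z‖ + η) + C / ‖z‖) * ‖z‖ ^ n ≤ c * Real.cos (n * θ) / 2 * ‖z‖ ^ n := by
    refine mul_le_mul_of_nonneg_right (le_trans ?_ hsmall) hp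
    gcongr
  linarith

/-- A trajectory that has stayed in the sector before time `t` and starts radially outward well
inside it is still in the sector at time `t`: the radial velocity increases, hence the radius does,
and the scaled energy is almost nonincreasing, which bounds `cos (n arg w)` from below. -/
theorem mem_openSector_of_forall_lt {n : ℕ} {a ad : ℕ → ℝ → ℂ} {c C η δ R θ₀ θp u₀ t : ℝ}
    {w v : ℝ → ℂ} (hn : 1 ≤ n) (hR : 1 ≤ R) (hc : 0 < c) (hθ₀ : 0 < θ₀) (hθ₀p : θ₀ < θp)
    (hθ : n * θp < Real.pi / 2) (ht : u₀ < t) (htδ : t - u₀ ≤ δ)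
    (ha : ∀ m s, HasDerivAt (a m) (ad m s) s)
    (hb : ∀ s ∈ Icc u₀ t, ∀ m ≤ n, (n + 1) ^ 2 * ‖a m s‖ ≤ C)
    (hd : ∀ s ∈ Icc u₀ t, ∀ m ≤ n, (n + 1) ^ 2 * ‖ad m s‖ ≤ C)
    (hbn : ∀ s ∈ Icc u₀ t, ‖a n s + c‖ ≤ η) (han : a n u₀ = -c)
    (hsmall : n * (C / R + η) + C / R ≤ c * Real.cos (n * θp) / 2)
    (hsmall' : 3 * (C / R) + C * δ + η < c * (Real.cos (n * θ₀) - Real.cos (n * θp)))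
    (hw : ∀ s ∈ Icc u₀ t, HasDerivWithinAt w (v s) (Icc u₀ t) s)
    (hv : ∀ s ∈ Icc u₀ t, HasDerivWithinAt v (force n (fun m => a m s) (w s)) (Icc u₀ t) s)
    (hstart : R < ‖w u₀‖) (harg : |arg (w u₀)| < θ₀)
    (hrad : 0 < radialVelocity (w u₀) (v u₀)) (hang : angularVelocity (w u₀) (v u₀) = 0)
    (hmem : ∀ s ∈ Ico u₀ t, w s ∈ openSector R θp) : w t ∈ openSector R θp := by
  have hn' : (1 : ℝ) ≤ n := by exact_mod_cast hn
  have hθp : 0 < θp := hθ₀.trans hθ₀p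
  have hθpn : θp ≤ n * θp := by nlinarith
  have hθpi : θp < Real.pi / 2 := hθpn.trans_lt hθ
  have hpi := Real.pi_pos
  have hu : u₀ ∈ Icc u₀ t := ⟨le_rfl, ht.le⟩
  have ht' : t ∈ Icc u₀ t := ⟨ht.le, le_rfl⟩
  have hC : 0 ≤ C := le_trans (by positivity) (hb u₀ hu 0 (Nat.zero_le _))
  have hcl : t ∈ closure (Ico u₀ t) := by rw [closure_Ico ht.ne]; exact ht'
  have hwc : ContinuousOn w (Icc u₀ t) := fun s hs => (hw s hs).continuousWithinAt
  have hwct : ContinuousWithinAt w (Ico u₀ t) t := (hwc t ht').mono Ico_subset_Icc_self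
  have hRt : R ≤ ‖w t‖ := ContinuousWithinAt.closure_le hcl (f := fun _ => R) (g := fun s => ‖w s‖)
    continuousWithinAt_const hwct.norm fun s hs => le_of_lt (hmem s hs).1
  have hw0t : w t ≠ 0 := norm_pos_iff.1 (by linarith)
  have hcost : ‖w t‖ * Real.cos θp ≤ (w t).re :=
    ContinuousWithinAt.closure_le hcl (f := fun s => ‖w s‖ * Real.cos θp) (g := fun s => (w s).re)
      (hwct.norm.mul continuousWithinAt_const)
      (Complex.continuous_re.continuousAt.comp_continuousWithinAt hwct)
      fun s hs => norm_mul_cos_le_of_abs_arg_le (by linarith) (hmem s hs).2.2.le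
  have hargt : |arg (w t)| ≤ θp := abs_arg_le_of_norm_mul_cos_le hw0t hθp.le (by linarith) hcost
  have hRle : ∀ s ∈ Icc u₀ t, R ≤ ‖w s‖ := fun s hs => by
    rcases hs.2.lt_or_eq with h | h
    · exact le_of_lt (hmem s ⟨hs.1, h⟩).1
    · rw [h]; exact hRt
  have hw0 : ∀ s ∈ Icc u₀ t, w s ≠ 0 := fun s hs => norm_pos_iff.1 (by linarith [hRle s hs])
  have hint : ∀ s ∈ interior (Icc u₀ t), s ∈ Icc u₀ t ∧ w s ∈ openSector R θp := fun s hs => by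
    rw [interior_Icc] at hs
    exact ⟨⟨hs.1.le, hs.2.le⟩, hmem s ⟨hs.1.le, hs.2⟩⟩
  have hrd := fun s hs => hasDerivWithinAt_radialVelocity (hw s hs) (hv s hs) (hw0 s hs)
  have hρd := fun s hs => hasDerivWithinAt_norm (hw s hs) (hw0 s hs)
  have hEd := fun s hs => hasDerivWithinAt_scaledEnergy (n := n) (fun m => ha m s) (hw s hs)
    (hv s hs) (hw0 s hs)
  have hcosp : 0 ≤ Real.cos (n * θp) :=
    Real.cos_nonneg_of_neg_pi_div_two_le_of_le (by linarith) hθ.le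
  -- The centrifugal term and the force both push outward, so the radial velocity increases.
  have hrmono : MonotoneOn (fun s => radialVelocity (w s) (v s)) (Icc u₀ t) := by
    refine monotoneOn_of_hasDerivWithinAt_nonneg (convex_Icc _ _)
      (fun s hs => (hrd s hs).continuousWithinAt)
      (fun s hs => (hrd s (interior_subset hs)).mono interior_subset) fun s hs => ?_
    obtain ⟨hsI, hsΩ⟩ := hint s hs
    have h1 := radial_force_lower hn hR hc hθ (hb s hsI) (hbn s hsI) hsmall hsΩ.1.le hsΩ.2.2.le
    have h2 : 0 ≤ c * Real.cos (n * θp) / 2 * ‖w s‖ ^ n := by positivity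
    have h3 := h2.trans h1
    positivity
  have hrpos : ∀ s ∈ Icc u₀ t, 0 < radialVelocity (w s) (v s) := fun s hs =>
    hrad.trans_le (hrmono hu hs hs.1)
  have hρmono : MonotoneOn (fun s => ‖w s‖) (Icc u₀ t) :=
    monotoneOn_of_hasDerivWithinAt_nonneg (convex_Icc _ _)
      (fun s hs => (hρd s hs).continuousWithinAt)
      (fun s hs => (hρd s (interior_subset hs)).mono interior_subset)
      fun s hs => (hrpos s (interior_subset hs)).le
  -- The terms `C / ‖w‖` and `-C (s - u₀)` compensate the two errors in the energy derivative.
  have hGd : ∀ s ∈ Icc u₀ t, HasDerivWithinAt (fun s =>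
      scaledEnergy n (∑ m ∈ Finset.range (n + 1), a m s * w s ^ m).re (w s) (v s)
        + C * ‖w s‖⁻¹ - C * (s - u₀)) _ (Icc u₀ t) s := fun s hs =>
    ((hEd s hs).add (((hρd s hs).inv (norm_ne_zero_iff.2 (hw0 s hs))).const_mul C)).sub
      (((hasDerivWithinAt_id s _).sub_const u₀).const_mul C)
  have hanti := antitoneOn_of_hasDerivWithinAt_nonpos (convex_Icc _ _)
    (fun s hs => (hGd s hs).continuousWithinAt)
    (fun s hs => (hGd s (interior_subset hs)).mono interior_subset) fun s hs => by
      obtain ⟨hsI, -⟩ := hint s hs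
      have hz1 : 1 ≤ ‖w s‖ := hR.trans (hRle s hsI)
      have hr := hrpos s hsI
      have h1 := (Complex.re_le_norm _).trans (norm_sum_le_pow (C := C) (fun m hm => le_trans
        (mul_le_mul_of_nonneg_right (by nlinarith) (norm_nonneg _)) (hd s hsI m hm)) hz1)
      have h2 := norm_euler_sub_le (C := C) (fun m hm => le_trans (le_of_eq (mul_assoc _ _ _).symm)
        (le_trans (mul_le_mul_of_nonneg_right (by nlinarith) (norm_nonneg _)) (hb s hsI m hm))) hz1
      rw [← le_div_iff₀ (by linarith)] at h2
      have h3 := (Complex.re_le_norm _).trans h2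
      have hz0 : 0 < ‖w s‖ := by linarith
      have hsq : 0 ≤ (n + 2) * (angularMomentum (w s) (v s) ^ 2 / (2 * ‖w s‖ ^ 2)) := by positivity
      have hpow : 0 < ‖w s‖ ^ n := by positivity
      have hrz : 0 ≤ radialVelocity (w s) (v s) / ‖w s‖ := by positivity
      have h4 := mul_le_mul_of_nonneg_left (sub_le_self _ hsq |>.trans h3) hrz
      have h5 := div_le_div_of_nonneg_right (add_le_add h1 h4) hpow.le
      have e : (C * ‖w s‖ ^ n + radialVelocity (w s) (v s) / ‖w s‖ * (C * ‖w s‖ ^ n / ‖w s‖)) /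
          ‖w s‖ ^ n = C + C * (radialVelocity (w s) (v s) / ‖w s‖ ^ 2) := by
        field_simp
      rw [e] at h5
      rw [neg_div]
      linarith
  have hG := hanti hu ht' ht.le
  have hL0 : angularMomentum (w u₀) (v u₀) = 0 := by
    have h0 : ‖w u₀‖ ^ 2 ≠ 0 := pow_ne_zero _ (norm_ne_zero_iff.2 (hw0 u₀ hu))
    rw [angularVelocity, div_eq_zero_iff] at hang
    exact hang.resolve_right h0
  have hval : ∀ s ∈ Icc u₀ t, ∀ η', ‖a n s + c‖ ≤ η' →
      |(∑ m ∈ Finset.range (n + 1), a m s * w s ^ m).re / ‖w s‖ ^ n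
        + c * Real.cos (n * arg (w s))| ≤ C / R + η' := by
    intro s hs η' hη'
    have hz1 : 1 ≤ ‖w s‖ := hR.trans (hRle s hs)
    have hpow : 0 < ‖w s‖ ^ n := by positivity
    have h1 := abs_re_sum_add_le (c := c) (C := C) (η := η')
      (fun m hm => le_trans (mul_le_mul_of_nonneg_right (by nlinarith) (norm_nonneg _))
        (hb s hs m hm)) hη' hz1
    rw [← div_le_iff₀ hpow, ← abs_of_pos hpow, ← abs_div, abs_of_pos hpow] at h1
    have e : ((∑ m ∈ Finset.range (n + 1), a m s * w s ^ m).re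
        + c * ‖w s‖ ^ n * Real.cos (n * arg (w s))) / ‖w s‖ ^ n =
        (∑ m ∈ Finset.range (n + 1), a m s * w s ^ m).re / ‖w s‖ ^ n
        + c * Real.cos (n * arg (w s)) := by field_simp
    rw [e] at h1
    refine h1.trans ?_
    have := hRle s hs
    gcongr
  have hv0 := (abs_le.1 (hval u₀ hu 0 (by simp [han]))).2
  have hvt := (abs_le.1 (hval t ht' η (hbn t ht'))).1
  have hE0 : scaledEnergy n (∑ m ∈ Finset.range (n + 1), a m u₀ * w u₀ ^ m).re (w u₀) (v u₀) =
      (∑ m ∈ Finset.range (n + 1), a m u₀ * w u₀ ^ m).re / ‖w u₀‖ ^ n := by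
    rw [scaledEnergy, hL0]; simp
  have hEt : (∑ m ∈ Finset.range (n + 1), a m t * w t ^ m).re / ‖w t‖ ^ n ≤
      scaledEnergy n (∑ m ∈ Finset.range (n + 1), a m t * w t ^ m).re (w t) (v t) := by
    rw [scaledEnergy]
    gcongr
    exact le_add_of_nonneg_left (by positivity)
  have hcos0 : Real.cos (n * θ₀) ≤ Real.cos (n * arg (w u₀)) := by
    rw [← Real.cos_abs (n * arg (w u₀)), abs_mul, Nat.abs_cast]
    refine Real.cos_le_cos_of_nonneg_of_le_pi (by positivity) ?_ (by gcongr)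
    nlinarith
  have hinv0 : C * ‖w u₀‖⁻¹ ≤ C / R := by
    rw [← div_eq_mul_inv]; gcongr
  have hinvt : 0 ≤ C * ‖w t‖⁻¹ := by positivity
  have hCδ : C * (t - u₀) ≤ C * δ := by gcongr
  have hfin : Real.cos (n * θp) < Real.cos (n * arg (w t)) := by
    have h1 : c * Real.cos (n * θ₀) ≤ c * Real.cos (n * arg (w u₀)) := by gcongr
    simp only [sub_self, mul_zero, sub_zero] at hG
    rw [hE0] at hG
    have : c * Real.cos (n * θp) < c * Real.cos (n * arg (w t)) := by linarith
    exact lt_of_mul_lt_mul_left this hc.le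
  have harglt : |arg (w t)| < θp := by
    by_contra! hge
    have : |arg (w t)| = θp := le_antisymm hargt hge
    rw [← Real.cos_abs (n * arg (w t)), abs_mul, Nat.abs_cast, this] at hfin
    exact lt_irrefl _ hfin
  refine ⟨hstart.trans_le (hρmono hu ht' ht.le), ?_, harglt⟩
  rw [mem_slitPlane_iff_arg]
  refine ⟨fun h => ?_, hw0t⟩
  rw [h, abs_of_pos hpi] at harglt
  linarith

/-! ### Finite-time blow-up -/

theorem mem_openSector_of_abs_arg_lt {R θ : ℝ} (hR : 0 ≤ R) (hθ : θ < Real.pi) {z : ℂ}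
    (hz : R < ‖z‖) (harg : |arg z| < θ) : z ∈ openSector R θ := by
  refine ⟨hz, mem_slitPlane_iff_arg.2 ⟨fun h => ?_, norm_pos_iff.1 (hR.trans_lt hz)⟩, harg⟩
  rw [h, abs_of_pos Real.pi_pos] at harg
  linarith

theorem rightInterval_coe (a b : ℝ) : rightInterval a (b : EReal) = Ico a b := by
  ext s
  simp [rightInterval]

/-- Finite-time blow-up in a sector around the positive real axis, for a polynomial potential
`Re (∑ aₘ(s) zᵐ)` of degree `n ≥ 3` whose leading coefficient is a negative real number at the
initial time. -/
theorem exists_sector_blowup {n : ℕ} (hn : 3 ≤ n) {a : ℕ → ℝ → ℂ} (ha : ∀ m, ContDiff ℝ 1 (a m))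
    {u₀ κ c θ₀ θp : ℝ} (hκ : 0 < κ) (hc : 0 < c) (han : a n u₀ = -c) (hθ₀ : 0 < θ₀)
    (hθ₀p : θ₀ < θp) (hθ : n * θp < Real.pi / 2) :
    ∃ R : ℝ, 0 < R ∧ ∀ (b : EReal) (w v : ℝ → ℂ), (u₀ : EReal) < b →
      (∀ s ∈ rightInterval u₀ b, s < u₀ + κ →
        HasDerivWithinAt w (v s) (rightInterval u₀ b) s ∧
        HasDerivWithinAt v (force n (fun m => a m s) (w s)) (rightInterval u₀ b) s) →
      R < ‖w u₀‖ → |arg (w u₀)| < θ₀ →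
      0 < radialVelocity (w u₀) (v u₀) → angularVelocity (w u₀) (v u₀) = 0 →
      (∀ s ∈ rightInterval u₀ b, w s ∈ openSector R θp) ∧ b < ((u₀ + κ : ℝ) : EReal) := by
  have hn' : (3 : ℝ) ≤ n := by exact_mod_cast hn
  have hpi := Real.pi_pos
  have hθp : 0 < θp := hθ₀.trans hθ₀p
  have hθpi : θp < Real.pi := by nlinarith
  have hcosp : 0 < Real.cos (n * θp) :=
    Real.cos_pos_of_mem_Ioo ⟨by nlinarith, hθ⟩
  have hcos : Real.cos (n * θp) < Real.cos (n * θ₀) :=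
    Real.strictAntiOn_cos ⟨by positivity, by nlinarith⟩ ⟨by positivity, by linarith⟩ (by gcongr)
  set ad : ℕ → ℝ → ℂ := fun m => deriv (a m) with had
  have had' : ∀ m s, HasDerivAt (a m) (ad m s) s := fun m s =>
    ((ha m).differentiable one_ne_zero s).hasDerivAt
  obtain ⟨C, hC⟩ : ∃ C : ℝ, ∀ s ∈ Icc u₀ (u₀ + κ), ∀ m ≤ n,
      (n + 1) ^ 2 * ‖a m s‖ ≤ C ∧ (n + 1) ^ 2 * ‖ad m s‖ ≤ C := by
    have hcont : Continuous fun s => ∑ m ∈ Finset.range (n + 1),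
        ((n + 1 : ℝ) ^ 2 * ‖a m s‖ + (n + 1) ^ 2 * ‖ad m s‖) := by
      refine continuous_finsetSum _ fun m _ => ?_
      have h1 := (ha m).continuous
      have h2 := (ha m).continuous_deriv le_rfl
      exact (continuous_const.mul h1.norm).add (continuous_const.mul h2.norm)
    obtain ⟨C, hC⟩ := (isCompact_Icc (a := u₀) (b := u₀ + κ)).bddAbove_image hcont.continuousOn
    refine ⟨C, fun s hs m hm => ?_⟩
    have h1 := hC ⟨s, hs, rfl⟩
    have h2 := Finset.single_le_sum
      (f := fun m => (n + 1 : ℝ) ^ 2 * ‖a m s‖ + (n + 1) ^ 2 * ‖ad m s‖)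
      (fun i _ => by positivity) (Finset.mem_range.2 (Nat.lt_succ_of_le hm))
    have h3 : 0 ≤ (n + 1 : ℝ) ^ 2 * ‖a m s‖ := by positivity
    have h4 : 0 ≤ (n + 1 : ℝ) ^ 2 * ‖ad m s‖ := by positivity
    constructor <;> (dsimp only at h1 h2; linarith)
  have hC0 : 0 ≤ C := le_trans (by positivity) (hC u₀ ⟨le_rfl, by linarith⟩ 0 (Nat.zero_le _)).1
  -- All error terms have to be small compared with `X`.
  set X : ℝ := min (c * Real.cos (n * θp) / 2) (c * (Real.cos (n * θ₀) - Real.cos (n * θp))) with hX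
  have hX0 : 0 < X := lt_min (by positivity) (mul_pos hc (by linarith))
  set η : ℝ := X / (4 * (n + 1)) with hη
  have hη0 : 0 < η := by positivity
  obtain ⟨δ₁, hδ₁, hδ₁a⟩ := Metric.continuousAt_iff.1
    ((ha n).continuous.continuousAt (x := u₀)) η hη0
  set δ : ℝ := min κ (min (δ₁ / 2) (X / (4 * (C + 1)))) with hδ
  have hδ0 : 0 < δ := lt_min hκ (lt_min (by positivity) (by positivity))
  have hδκ : δ ≤ κ := min_le_left _ _
  have hδδ₁ : δ ≤ δ₁ / 2 := (min_le_right _ _).trans (min_le_left _ _)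
  have hδX : C * δ ≤ X / 4 := by
    have h1 : δ ≤ X / (4 * (C + 1)) := (min_le_right _ _).trans (min_le_right _ _)
    rw [le_div_iff₀ (by positivity)] at h1
    nlinarith
  set c₁ : ℝ := c * Real.cos (n * θp) / 2 with hc₁
  have hc₁0 : 0 < c₁ := by positivity
  -- The second summand makes the lower order terms small, the third one forces blow-up in time
  -- `δ / 2`.
  set R : ℝ := 1 + 8 * (n + 1) * C / X + 24 / (c₁ * (δ / 2) ^ 2) with hR
  have hR1 : 1 ≤ R := by
    have h1 : 0 ≤ 8 * (n + 1) * C / X := by positivity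
    have h2 : 0 ≤ 24 / (c₁ * (δ / 2) ^ 2) := by positivity
    linarith
  have hR2 : 24 / (c₁ * (δ / 2) ^ 2) ≤ R := by
    have h1 : 0 ≤ 8 * (n + 1) * C / X := by positivity
    linarith
  have hCR : C / R ≤ X / (8 * (n + 1)) := by
    have h1 : 8 * (n + 1) * C / X ≤ R := by
      have h2 : 0 ≤ 24 / (c₁ * (δ / 2) ^ 2) := by positivity
      linarith
    rw [div_le_iff₀ hX0] at h1
    rw [div_le_div_iff₀ (by linarith) (by positivity)]
    linarith
  have hCR' : C / R ≤ X / 32 := hCR.trans (by gcongr; linarith)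
  have hη' : η ≤ X / 16 := by rw [hη]; gcongr; linarith
  have hsmall : n * (C / R + η) + C / R ≤ c₁ := by
    have h1 : (n + 1) * (C / R) ≤ X / 8 := by
      calc (n + 1) * (C / R) ≤ (n + 1) * (X / (8 * (n + 1))) := by gcongr
        _ = X / 8 := by field_simp
    have h2 : (n + 1) * η = X / 4 := by rw [hη]; field_simp
    have h3 : X ≤ c₁ := min_le_left _ _
    nlinarith
  have hsmall' : 3 * (C / R) + C * δ + η < c * (Real.cos (n * θ₀) - Real.cos (n * θp)) := by
    have h3 : X ≤ c * (Real.cos (n * θ₀) - Real.cos (n * θp)) := min_le_right _ _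
    linarith
  have hbn : ∀ s ∈ Icc u₀ (u₀ + δ), ‖a n s + c‖ ≤ η := by
    intro s hs
    have h1 : dist s u₀ < δ₁ := by
      rw [Real.dist_eq, abs_of_nonneg (by linarith [hs.1])]
      linarith [hs.2]
    have h2 := (hδ₁a h1).le
    rwa [dist_eq_norm, han, sub_neg_eq_add] at h2
  refine ⟨R, by linarith, fun b w v hb hODE hwR harg hrad hang => ?_⟩
  have hinv : ∀ β, β ≤ u₀ + δ → Ico u₀ β ⊆ rightInterval u₀ b →
      ∀ t ∈ Ico u₀ β, w t ∈ openSector R θp := by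
    intro β hβ hsub
    have hder : ∀ s ∈ Ico u₀ β, _ := fun s hs =>
      hODE s (hsub hs) (by linarith [hs.2])
    refine forall_mem_of_isOpen_of_forall_lt (isOpen_openSector R θp)
      (fun s hs => ((hder s hs).1.mono hsub).continuousWithinAt)
      (mem_openSector_of_abs_arg_lt (by linarith) hθpi hwR (harg.trans hθ₀p)) fun t ht hmem => ?_
    have hsubt : Icc u₀ t ⊆ Ico u₀ β := fun s hs => ⟨hs.1, hs.2.trans_lt ht.2⟩
    have hκs : ∀ s ∈ Icc u₀ t, s ∈ Icc u₀ (u₀ + κ) := fun s hs =>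
      ⟨hs.1, by linarith [hs.2, ht.2]⟩
    exact mem_openSector_of_forall_lt (δ := δ) (by omega) hR1 hc hθ₀ hθ₀p hθ ht.1
      (by linarith [ht.2]) had' (fun s hs m hm => (hC s (hκs s hs) m hm).1)
      (fun s hs m hm => (hC s (hκs s hs) m hm).2)
      (fun s hs => hbn s ⟨hs.1, by linarith [hs.2, ht.2]⟩) han hsmall hsmall'
      (fun s hs => (hder s (hsubt hs)).1.mono (hsubt.trans hsub))
      (fun s hs => (hder s (hsubt hs)).2.mono (hsubt.trans hsub)) hwR harg hrad hang hmem
  have hble : b ≤ ((u₀ + δ / 2 : ℝ) : EReal) := by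
    by_contra! hlt
    obtain ⟨β, hβ1, hβ2⟩ := EReal.lt_iff_exists_real_btwn.1 hlt
    have hβ1 : u₀ + δ / 2 < β := by exact_mod_cast hβ1
    have hsub : Ico u₀ (min β (u₀ + δ)) ⊆ rightInterval u₀ b := fun s hs =>
      ⟨hs.1, lt_trans (by exact_mod_cast hs.2.trans_le (min_le_left _ _)) hβ2⟩
    have hmem := hinv _ (min_le_right _ _) hsub
    have hsub' : Icc u₀ (u₀ + δ / 2) ⊆ Ico u₀ (min β (u₀ + δ)) := fun s hs =>
      ⟨hs.1, hs.2.trans_lt (lt_min hβ1 (by linarith))⟩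
    have hder := fun s (hs : s ∈ Icc u₀ (u₀ + δ / 2)) =>
      hODE s (hsub (hsub' hs)) (by linarith [hs.2])
    have hw0 : ∀ s ∈ Icc u₀ (u₀ + δ / 2), w s ≠ 0 := fun s hs => by
      have h1 : R < ‖w s‖ := (hmem s (hsub' hs)).1
      exact norm_pos_iff.1 (by linarith)
    refine blowup_of_quadratic_acceleration (ρ := fun s => ‖w s‖) hc₁0 (half_pos hδ0)
      (fun s hs => (hasDerivWithinAt_norm (hder s hs).1 (hw0 s hs)).mono (hsub'.trans hsub))
      (fun s hs => (hasDerivWithinAt_radialVelocity (hder s hs).1 (hder s hs).2 (hw0 s hs)).mono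
        (hsub'.trans hsub)) (fun s hs => ?_) hrad.le (hR2.trans_lt hwR)
    have hΩ := hmem s (hsub' hs)
    have hz : R < ‖w s‖ := hΩ.1
    have hz1 : 1 ≤ ‖w s‖ := by linarith
    have h1 := radial_force_lower (by omega) hR1 hc hθ
      (fun m hm => (hC s ⟨hs.1, by linarith [hs.2]⟩ m hm).1)
      (hbn s ⟨hs.1, by linarith [hs.2]⟩) hsmall hΩ.1.le hΩ.2.2.le
    have h2 : ‖w s‖ ^ 3 ≤ ‖w s‖ ^ n := pow_le_pow_right₀ hz1 hn
    refine le_add_of_nonneg_of_le (by positivity) ?_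
    rw [le_div_iff₀ (by linarith)]
    calc c₁ * ‖w s‖ ^ 2 * ‖w s‖ = c₁ * ‖w s‖ ^ 3 := by ring
      _ ≤ c₁ * ‖w s‖ ^ n := by gcongr
      _ ≤ _ := h1
  have hbtop : b ≠ ⊤ := ne_top_of_le_ne_top (EReal.coe_ne_top _) hble
  have hbbot : b ≠ ⊥ := ne_bot_of_gt hb
  lift b to ℝ using ⟨hbtop, hbbot⟩
  have hble : b ≤ u₀ + δ / 2 := by exact_mod_cast hble
  refine ⟨fun s hs => hinv b (by linarith) (rightInterval_coe u₀ b).ge s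
    ((rightInterval_coe u₀ b).le hs), ?_⟩
  exact_mod_cast (by linarith : b < u₀ + κ)

/-! ### Other directions: rotation of the plane -/

/-- The force in the coordinate rotated by the angle `φ`. -/
theorem force_rotate (n : ℕ) (b : ℕ → ℂ) (φ : ℝ) (z : ℂ) :
    force n (fun m => b m * Complex.exp (m * (φ * I))) (Complex.exp (-(φ * I)) * z) =
      Complex.exp (-(φ * I)) * force n b z := by
  have hconj : Complex.exp (-(φ * I)) = (starRingEnd ℂ) (Complex.exp (φ * I)) := by
    rw [← Complex.exp_conj]; simp
  rw [force, force, mul_neg, hconj, ← map_mul, ← hconj, Finset.mul_sum]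
  congr 2
  refine Finset.sum_congr rfl fun m _ => ?_
  rcases Nat.eq_zero_or_pos m with rfl | hm
  · simp
  · rw [mul_pow, ← Complex.exp_nat_mul,
      show Complex.exp (m * (φ * I)) = Complex.exp (((m - 1 : ℕ) : ℂ) * (φ * I))
        * Complex.exp (φ * I) by
        rw [← Complex.exp_add]; congr 1; push_cast [hm]; ring]
    have : Complex.exp (((m - 1 : ℕ) : ℂ) * (φ * I)) *
        Complex.exp (((m - 1 : ℕ) : ℂ) * (-(φ * I))) = 1 := by
      rw [← Complex.exp_add]; simp
    linear_combination (m * b m * Complex.exp (φ * I) * z ^ (m - 1)) * this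

theorem norm_exp_neg_mul_I (φ : ℝ) : ‖Complex.exp (-(φ * I))‖ = 1 := by
  rw [← neg_mul, ← ofReal_neg, Complex.norm_exp_ofReal_mul_I]

theorem radialVelocity_angularVelocity_rotate {e : ℂ} (he : ‖e‖ = 1) (z v : ℂ) :
    radialVelocity (e * z) (e * v) = radialVelocity z v ∧
      angularVelocity (e * z) (e * v) = angularVelocity z v := by
  have h := norm_sq_eq e
  rw [he, one_pow] at h
  simp only [radialVelocity, angularVelocity, norm_mul, he, one_mul, mul_re, mul_im]
  constructor
  · congr 1
    linear_combination (-(z.re * v.re + z.im * v.im)) * h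
  · congr 1
    linear_combination (-(z.re * v.im - z.im * v.re)) * h

/-- Finite-time blow-up along any direction `φ` in which the leading part of the potential is
negative and minimal on the unit circle. -/
theorem exists_sector_blowup_direction {V : ℂ → ℝ → ℝ} {n : ℕ} (hn : 3 ≤ n) {a : ℕ → ℝ → ℂ}
    (ha : ∀ m, ContDiff ℝ 1 (a m)) {u₀ κ c θ₀ θp φ : ℝ} (hκ : 0 < κ)
    (hVa : ∀ u ∈ Ioo (u₀ - κ) (u₀ + κ), ∀ z,
      V z u = (∑ m ∈ Finset.range (n + 1), a m u * z ^ m).re)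
    (hc : 0 < c) (han : a n u₀ * Complex.exp (n * (φ * I)) = -c) (hθ₀ : 0 < θ₀)
    (hθ₀p : θ₀ < θp) (hθ : n * θp < Real.pi / 2) :
    ∃ R : ℝ, 0 < R ∧ ∀ (b : EReal) (γ v : ℝ → ℂ), (u₀ : EReal) < b →
      IsTrajectory V (rightInterval u₀ b) γ v →
      Complex.exp (-(φ * I)) * γ u₀ ∈ openSector R θ₀ →
      0 < radialVelocity (γ u₀) (v u₀) → angularVelocity (γ u₀) (v u₀) = 0 →
      (∀ s ∈ rightInterval u₀ b, Complex.exp (-(φ * I)) * γ s ∈ openSector R θp) ∧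
        b < ((u₀ + κ : ℝ) : EReal) := by
  obtain ⟨R, hR, H⟩ := exists_sector_blowup hn
    (a := fun m s => a m s * Complex.exp (m * (φ * I)))
    (fun m => (ha m).mul contDiff_const) hκ hc han hθ₀ hθ₀p hθ
  refine ⟨R, hR, fun b γ v hb htraj hmem hrad hang => ?_⟩
  have hrot := radialVelocity_angularVelocity_rotate (norm_exp_neg_mul_I φ) (γ u₀) (v u₀)
  refine H b (fun s => Complex.exp (-(φ * I)) * γ s) (fun s => Complex.exp (-(φ * I)) * v s) hb
    (fun s hs hsκ => ?_) hmem.1 hmem.2.2 (hrot.1.symm ▸ hrad) (hrot.2.trans hang)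
  obtain ⟨h1, h2⟩ := htraj s hs
  refine ⟨h1.const_mul _, ?_⟩
  rw [force_rotate n (fun m => a m s)]
  have hfun : (fun z => V z s) = fun z => (∑ m ∈ Finset.range (n + 1), a m s * z ^ m).re :=
    funext fun z => hVa s ⟨by linarith [hs.1], hsκ⟩ z
  rw [hfun, gradient_re_sum (fun m => a m s)] at h2
  exact h2.const_mul _

theorem exp_mul_mem_openSector_iff {R θ : ℝ} (hR : 0 ≤ R) (hθ : θ < Real.pi) {φ : ℝ} {z : ℂ} :
    Complex.exp (-(φ * I)) * z ∈ openSector R θ ↔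
      ∃ ρ θ' : ℝ, R < ρ ∧ |θ' - φ| < θ ∧ z = polarPoint ρ θ' := by
  constructor
  · rintro ⟨h1, h2, h3⟩
    refine ⟨‖z‖, arg (Complex.exp (-(φ * I)) * z) + φ, ?_, by simpa using h3, ?_⟩
    · simpa [norm_exp_neg_mul_I] using h1
    · have h := Complex.norm_mul_exp_arg_mul_I (Complex.exp (-(φ * I)) * z)
      rw [norm_mul, norm_exp_neg_mul_I, one_mul] at h
      rw [polarPoint, ofReal_add, add_mul, Complex.exp_add, ← mul_assoc, h, mul_right_comm,
        ← Complex.exp_add]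
      simp
  · rintro ⟨ρ, θ', h1, h2, rfl⟩
    have hρ : 0 < ρ := hR.trans_lt h1
    have e : Complex.exp (-(φ * I)) * polarPoint ρ θ' =
        ρ * Complex.exp ((θ' - φ : ℝ) * I) := by
      rw [polarPoint, mul_left_comm, ← Complex.exp_add]
      congr 2
      push_cast
      ring
    obtain ⟨h3, h4⟩ := abs_lt.1 h2
    have harg : arg (ρ * Complex.exp ((θ' - φ : ℝ) * I)) = θ' - φ := by
      rw [Complex.arg_real_mul _ hρ, Complex.arg_exp_mul_I]
      exact (toIocMod_eq_self _).2 ⟨by linarith, by linarith⟩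
    rw [e]
    refine mem_openSector_of_abs_arg_lt hR hθ ?_ (by rwa [harg])
    rw [norm_mul, Complex.norm_exp_ofReal_mul_I, mul_one, Complex.norm_real, Real.norm_eq_abs]
    exact h1.trans_le (le_abs_self ρ)

theorem mem_sector_iff {n k : ℕ} {R θ : ℝ} (hR : 0 ≤ R) (hθ : θ < Real.pi) {z : ℂ} :
    z ∈ sector n k R θ ↔
      Complex.exp (-(((2 * Real.pi * k / n : ℝ) : ℂ) * I)) * z ∈ openSector R θ :=
  (exp_mul_mem_openSector_iff hR hθ).symm

theorem exists_coeff_of_hasPolarExpression {V : ℂ → ℝ → ℝ} {I : Set ℝ} {n : ℕ} {lam al : ℝ → ℝ}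
    {lamLow alLow : ℕ → ℝ → ℝ} (h : HasPolarExpression V I n lam al lamLow alLow) {u : ℝ}
    (hu : u ∈ I) :
    ∃ b : ℕ → ℂ, b n = -(lam u * Complex.exp (((n * al u : ℝ) : ℂ) * Complex.I)) ∧
      ∀ z, z ≠ 0 → V z u = (∑ m ∈ Finset.range (n + 1), b m * z ^ m).re := by
  refine ⟨fun m => if m = n then -(lam u * Complex.exp (((n * al u : ℝ) : ℂ) * Complex.I)) else
    -(lamLow m u * Complex.exp (((m * alLow m u : ℝ) : ℂ) * Complex.I)), by simp, fun z hz => ?_⟩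
  have hpol : polarPoint ‖z‖ (arg z) = z := Complex.norm_mul_exp_arg_mul_I z
  have hterm : ∀ (m : ℕ) (l α : ℝ), (-((l : ℂ) * Complex.exp (((m * α : ℝ) : ℂ) * Complex.I))
      * z ^ m).re = -(l * ‖z‖ ^ m * Real.cos (m * (arg z + α))) := by
    intro m l α
    conv_lhs => rw [← hpol, polarPoint, mul_pow, ← Complex.exp_nat_mul]
    rw [neg_mul, neg_re, show (l : ℂ) * Complex.exp (((m * α : ℝ) : ℂ) * Complex.I) *
      ((‖z‖ : ℂ) ^ m * Complex.exp (m * (arg z * Complex.I))) =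
      ((l * ‖z‖ ^ m : ℝ) : ℂ) * Complex.exp (((m * (arg z + α) : ℝ) : ℂ) * Complex.I) by
        rw [show ((m * (arg z + α) : ℝ) : ℂ) * Complex.I = ((m * α : ℝ) : ℂ) * Complex.I
          + m * (arg z * Complex.I) by push_cast; ring, Complex.exp_add]
        push_cast
        ring, re_ofReal_mul, Complex.exp_ofReal_mul_I_re]
  have := h u hu ‖z‖ (norm_pos_iff.2 hz) (arg z)
  rw [hpol] at this
  beta_reduce
  rw [this, Finset.sum_range_succ, if_pos rfl, add_re, hterm, Complex.re_sum,
    sub_eq_neg_add, ← Finset.sum_neg_distrib]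
  congr 1
  refine Finset.sum_congr rfl fun m hm => ?_
  rw [if_neg (Finset.mem_range.1 hm).ne, hterm]

/-- Blow-up in each of the sectors around the directions `2πk/n`. The rotation by `2πk/n` leaves the
leading coefficient unchanged, which reduces this to the sector around the positive real axis. -/
theorem sector_blowup_of_isNormalizedAt {V : ℂ → ℝ → ℝ} (hV : IsHarmonicPotential V) {n : ℕ}
    {u₀ κ₀ : ℝ} (hn : 3 ≤ n) (hκ₀ : 0 < κ₀) (hnorm : IsNormalizedAt V n u₀ κ₀) {θ₀ θp : ℝ}
    (hθ₀ : 0 < θ₀) (hθ₀p : θ₀ < θp) (hθ : θp < Real.pi / (2 * n)) (k : ℕ) :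
    ∃ ρ₀ : ℝ, 0 < ρ₀ ∧ ∀ (b : EReal) (γ v : ℝ → ℂ), (u₀ : EReal) < b →
      IsTrajectory V (rightInterval u₀ b) γ v → γ u₀ ∈ sector n k ρ₀ θ₀ →
      0 < radialVelocity (γ u₀) (v u₀) → angularVelocity (γ u₀) (v u₀) = 0 →
      (∀ s ∈ rightInterval u₀ b, γ s ∈ sector n k ρ₀ θp) ∧ b < ((u₀ + κ₀ : ℝ) : EReal) := by
  obtain ⟨lam, al, lamLow, alLow, hpol, hal, hlam, -⟩ := hnorm
  obtain ⟨a, ha, hVa⟩ := exists_contDiff_coeff hV.contDiff fun u hu =>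
    (exists_coeff_of_hasPolarExpression hpol hu).imp fun _ h => h.2
  have hn' : (3 : ℝ) ≤ n := by exact_mod_cast hn
  have hu₀ : u₀ ∈ Ioo (u₀ - κ₀) (u₀ + κ₀) := ⟨by linarith, by linarith⟩
  have han : a n u₀ = -(lam u₀ : ℂ) := by
    obtain ⟨b, hb, hVb⟩ := exists_coeff_of_hasPolarExpression hpol hu₀
    rw [coeff_unique (a := fun m => a m u₀) (b := b) (N := n)
      (fun z hz => (hVa u₀ hu₀ z).symm.trans (hVb z hz)) (by omega) le_rfl, hb, hal]
    simp
  have hrot : Complex.exp (n * (((2 * Real.pi * k / n : ℝ) : ℂ) * I)) = 1 := by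
    rw [Complex.exp_eq_one_iff]
    refine ⟨k, ?_⟩
    have : (n : ℂ) ≠ 0 := by exact_mod_cast (by omega : n ≠ 0)
    push_cast
    field_simp
  have hθn : n * θp < Real.pi / 2 := by
    rw [lt_div_iff₀ (by positivity)] at hθ
    linarith
  have hθpi : θp < Real.pi := by nlinarith [Real.pi_pos]
  obtain ⟨R, hR, H⟩ := exists_sector_blowup_direction (φ := 2 * Real.pi * k / n) hn ha hκ₀ hVa
    (c := lam u₀) (by linarith) (by rw [hrot, mul_one, han]) hθ₀ hθ₀p hθn
  refine ⟨R, hR, fun b γ v hb htraj hmem hrad hang => ?_⟩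
  rw [mem_sector_iff hR.le (hθ₀p.trans hθpi)] at hmem
  obtain ⟨h1, h2⟩ := H b γ v hb htraj hmem hrad hang
  exact ⟨fun s hs => (mem_sector_iff hR.le hθpi).2 (h1 s hs), h2⟩

/-! ### Local form of a potential that is not quadratic -/

/-- Near each time, a polynomially bounded potential is a polynomial of bounded degree with `C¹`
coefficients. -/
theorem exists_local_coeff {V : ℂ → ℝ → ℝ} (hV : IsHarmonicPotential V)
    (hb : PolynomiallyUBounded V) (u₀ : ℝ) :
    ∃ ε > 0, ∃ N, 2 ≤ N ∧ ∃ a : ℕ → ℝ → ℂ, (∀ m, ContDiff ℝ 1 (a m)) ∧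
      ∀ u ∈ Ioo (u₀ - ε) (u₀ + ε), ∀ z,
        V z u = (∑ m ∈ Finset.range (N + 1), a m u * z ^ m).re := by
  obtain ⟨ε, hε, q, hq⟩ := hb u₀
  refine ⟨ε, hε, max q.totalDegree 2, le_max_right _ _, ?_⟩
  refine exists_contDiff_coeff hV.contDiff fun u hu => ?_
  obtain ⟨b, hb⟩ := exists_eq_re_sum_of_harmonic (hV.harmonic u) (le_max_left _ _)
    fun z => hq z u hu
  exact ⟨b, fun z _ => hb z⟩

theorem exists_quadratic_of_re_sum (a : ℕ → ℂ) :
    ∃ q : MvPolynomial (Fin 2) ℝ, q.totalDegree ≤ 2 ∧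
      ∀ z : ℂ, (∑ m ∈ Finset.range 3, a m * z ^ m).re = evalPoly q z := by
  open MvPolynomial in
  refine ⟨C (a 0).re + (C (a 1).re * X 0 - C (a 1).im * X 1) +
    (C (a 2).re * (X 0 ^ 2 - X 1 ^ 2) - C (2 * (a 2).im) * (X 0 * X 1)), ?_, fun z => ?_⟩
  · have hX : ∀ i : Fin 2, (X i : MvPolynomial (Fin 2) ℝ).totalDegree ≤ 1 := fun i => by simp
    have hX2 : ∀ i : Fin 2, (X i ^ 2 : MvPolynomial (Fin 2) ℝ).totalDegree ≤ 2 := fun i => by simp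
    have hC : ∀ (r : ℝ) {p : MvPolynomial (Fin 2) ℝ} {d : ℕ}, p.totalDegree ≤ d →
        (C r * p).totalDegree ≤ d := fun r p d h =>
      (totalDegree_mul _ _).trans (by simpa using h)
    have hXX : (X 0 * X 1 : MvPolynomial (Fin 2) ℝ).totalDegree ≤ 2 :=
      (totalDegree_mul _ _).trans (add_le_add (hX 0) (hX 1))
    refine (totalDegree_add _ _).trans (max_le ((totalDegree_add _ _).trans (max_le (by simp) ?_))
      ?_)
    · exact (totalDegree_sub _ _).trans
        (max_le ((hC _ (hX 0)).trans one_le_two) ((hC _ (hX 1)).trans one_le_two))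
    · exact (totalDegree_sub _ _).trans (max_le
        (hC _ ((totalDegree_sub _ _).trans (max_le (hX2 0) (hX2 1)))) (hC _ hXX))
  · simp [Finset.sum_range_succ, evalPoly, pow_two]
    ring

/-- If `V` is not quadratic, then near some time it is a polynomial of a locally maximal degree
`n ≥ 3` that is attained at that time. -/
theorem exists_leading_coeff {V : ℂ → ℝ → ℝ} (hV : IsHarmonicPotential V)
    (hb : PolynomiallyUBounded V) (hnot : ¬ AtMostQuadratic V) :
    ∃ n, 3 ≤ n ∧ ∃ u₀ κ : ℝ, 0 < κ ∧ ∃ a : ℕ → ℝ → ℂ, (∀ m, ContDiff ℝ 1 (a m)) ∧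
      (∀ u ∈ Ioo (u₀ - κ) (u₀ + κ), ∀ z,
        V z u = (∑ m ∈ Finset.range (n + 1), a m u * z ^ m).re) ∧ a n u₀ ≠ 0 := by
  rw [AtMostQuadratic] at hnot
  push Not at hnot
  obtain ⟨u₁, hu₁⟩ := hnot
  obtain ⟨ε, hε, N, hN, a, ha, hVa⟩ := exists_local_coeff hV hb u₁
  have hu₁I : u₁ ∈ Ioo (u₁ - ε) (u₁ + ε) := ⟨by linarith, by linarith⟩
  classical
  set P : ℕ → Prop := fun m => ∃ u ∈ Ioo (u₁ - ε) (u₁ + ε), a m u ≠ 0 with hP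
  obtain ⟨m, hm3, hmN, hPm⟩ : ∃ m, 3 ≤ m ∧ m ≤ N ∧ P m := by
    by_contra! hcon
    obtain ⟨q, hq, hqe⟩ := exists_quadratic_of_re_sum fun m => a m u₁
    obtain ⟨z, hz⟩ := hu₁ q hq
    refine hz ?_
    rw [hVa u₁ hu₁I, ← hqe]
    congr 1
    symm
    refine Finset.sum_subset (fun i hi => ?_) fun i hi hi' => ?_
    · simp at hi ⊢; omega
    · simp at hi hi'
      have : a i u₁ = 0 := by
        by_contra h
        exact hcon i hi' (by omega) ⟨u₁, hu₁I, h⟩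
      rw [this, zero_mul]
  set n := Nat.findGreatest P N with hn
  have hmn : m ≤ n := Nat.le_findGreatest hmN hPm
  obtain ⟨u₀, hu₀, hau₀⟩ : P n := Nat.findGreatest_spec hmN hPm
  obtain ⟨κ, hκ, hball⟩ := Metric.isOpen_iff.1 isOpen_Ioo u₀ hu₀
  rw [Real.ball_eq_Ioo] at hball
  refine ⟨n, hm3.trans hmn, u₀, κ, hκ, a, ha, fun u hu z => ?_, hau₀⟩
  rw [hVa u (hball hu)]
  congr 1
  symm
  refine Finset.sum_subset (fun i hi => ?_) fun i hi hi' => ?_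
  · have := Nat.findGreatest_le (P := P) N
    simp at hi ⊢; omega
  · simp at hi hi'
    have : a i u = 0 := by
      by_contra h
      exact Nat.findGreatest_is_greatest (P := P) (n := N) hi' (by omega) ⟨u, hball hu, h⟩
    rw [this, zero_mul]

/-! ### Gluing and extension of trajectories -/

theorem IsTrajectory.mono {V : ℂ → ℝ → ℝ} {J J' : Set ℝ} {γ v : ℝ → ℂ} (h : IsTrajectory V J γ v)
    (hJ : J' ⊆ J) : IsTrajectory V J' γ v := fun s hs =>
  ⟨(h s (hJ hs)).1.mono hJ, (h s (hJ hs)).2.mono hJ⟩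

/-- Being a trajectory can be checked locally, on open sets that may be glued arbitrarily. -/
theorem isTrajectory_of_local {V : ℂ → ℝ → ℝ} {J : Set ℝ} {γ v : ℝ → ℂ}
    (h : ∀ s ∈ J, ∃ (J' : Set ℝ) (γ' v' : ℝ → ℂ), IsOpen J' ∧ s ∈ J' ∧ IsTrajectory V J' γ' v' ∧
      EqOn γ γ' J' ∧ EqOn v v' J') : IsTrajectory V J γ v := by
  intro s hs
  obtain ⟨J', γ', v', hJ', hsJ', htraj, hγ, hv⟩ := h s hs
  have hnhds := hJ'.mem_nhds hsJ'
  obtain ⟨h1, h2⟩ := htraj s hsJ'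
  rw [hγ hsJ', hv hsJ']
  exact
    ⟨((h1.hasDerivAt hnhds).congr_of_eventuallyEq (hγ.eventuallyEq_of_mem hnhds)).hasDerivWithinAt,
    ((h2.hasDerivAt hnhds).congr_of_eventuallyEq (hv.eventuallyEq_of_mem hnhds)).hasDerivWithinAt⟩

theorem IsTrajectory.velocity_eqOn {V : ℂ → ℝ → ℝ} {J J' : Set ℝ} {γ v γ' v' : ℝ → ℂ}
    (hJ : IsOpen J) (hJJ' : J ⊆ J') (h : IsTrajectory V J γ v) (h' : IsTrajectory V J' γ' v')
    (heq : EqOn γ' γ J) : EqOn v' v J := by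
  intro s hs
  have hnhds := hJ.mem_nhds hs
  have h1 := (h s hs).1.hasDerivAt hnhds
  have h2 := (h'.mono hJJ' s hs).1.hasDerivAt hnhds
  exact (h2.congr_of_eventuallyEq (heq.symm.eventuallyEq_of_mem hnhds)).unique h1

/-- The graph of a trajectory in extended phase space. -/
def phaseGraph (J : Set ℝ) (γ v : ℝ → ℂ) : Set (ℝ × ℂ × ℂ) := (fun s => (s, γ s, v s)) '' J

theorem mem_phaseGraph {J : Set ℝ} {γ v : ℝ → ℂ} {p : ℝ × ℂ × ℂ} :
    p ∈ phaseGraph J γ v ↔ p.1 ∈ J ∧ p.2 = (γ p.1, v p.1) := by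
  constructor
  · rintro ⟨s, hs, rfl⟩
    exact ⟨hs, rfl⟩
  · rintro ⟨h1, h2⟩
    exact ⟨p.1, h1, Prod.ext rfl h2.symm⟩

/-- Every trajectory on an open interval extends to an inextensible one. -/
theorem exists_inextensible {V : ℂ → ℝ → ℝ} {J₀ : Set ℝ} {γ₀ v₀ : ℝ → ℂ} (hJ₀ : IsOpenInterval J₀)
    (h₀ : IsTrajectory V J₀ γ₀ v₀) :
    ∃ (J : Set ℝ) (γ v : ℝ → ℂ), IsOpenInterval J ∧ J₀ ⊆ J ∧ EqOn γ γ₀ J₀ ∧ EqOn v v₀ J₀ ∧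
      IsTrajectory V J γ v ∧ IsInextensible V J γ := by
  set S : Set (Set (ℝ × ℂ × ℂ)) := {G | ∃ (J : Set ℝ) (γ v : ℝ → ℂ), IsOpenInterval J ∧
    IsTrajectory V J γ v ∧ G = phaseGraph J γ v} with hS
  obtain ⟨G, hG₀, ⟨J, γ, v, hJ, htraj, rfl⟩, hmax⟩ := zorn_subset_nonempty S (by
    intro c hcS hchain hne
    have hfun : ∀ p ∈ ⋃₀ c, ∀ q ∈ ⋃₀ c, p.1 = q.1 → p = q := by
      rintro p ⟨G₁, hG₁, hp⟩ q ⟨G₂, hG₂, hq⟩ hpq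
      obtain ⟨G, hG, hp, hq⟩ : ∃ G ∈ c, p ∈ G ∧ q ∈ G := by
        rcases hchain.total hG₁ hG₂ with h | h
        · exact ⟨G₂, hG₂, h hp, hq⟩
        · exact ⟨G₁, hG₁, hp, h hq⟩
      obtain ⟨J, γ, v, -, -, rfl⟩ := hcS hG
      rw [mem_phaseGraph] at hp hq
      exact Prod.ext hpq (by rw [hp.2, hq.2, hpq])
    set J : Set ℝ := Prod.fst '' ⋃₀ c with hJ
    have hex : ∀ s : ℝ, ∃ y : ℂ × ℂ, s ∈ J → (s, y) ∈ ⋃₀ c := by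
      intro s
      by_cases hs : s ∈ J
      · obtain ⟨p, hp, rfl⟩ := hs
        exact ⟨p.2, fun _ => hp⟩
      · exact ⟨0, fun h => absurd h hs⟩
    choose f hf using hex
    have hlocal : ∀ G ∈ c, ∃ (J' : Set ℝ) (γ' v' : ℝ → ℂ), IsOpenInterval J' ∧
        IsTrajectory V J' γ' v' ∧ G = phaseGraph J' γ' v' ∧ J' ⊆ J ∧
        EqOn (fun s => (f s).1) γ' J' ∧ EqOn (fun s => (f s).2) v' J' := by
      intro G hG
      obtain ⟨J', γ', v', h1, h2, rfl⟩ := hcS hG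
      have hsub : ∀ s ∈ J', (s, γ' s, v' s) ∈ ⋃₀ c := fun s hs => ⟨_, hG, ⟨s, hs, rfl⟩⟩
      have hsubJ : J' ⊆ J := fun s hs => ⟨_, hsub s hs, rfl⟩
      have heq : ∀ s ∈ J', f s = (γ' s, v' s) := fun s hs =>
        congrArg Prod.snd (hfun _ (hf s (hsubJ hs)) _ (hsub s hs) rfl)
      exact ⟨J', γ', v', h1, h2, rfl, hsubJ, fun s hs => by simp [heq s hs],
        fun s hs => by simp [heq s hs]⟩
    have hmemJ : ∀ s ∈ J, ∃ G ∈ c, ∃ y, (s, y) ∈ G := by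
      rintro s ⟨p, ⟨G, hG, hp⟩, rfl⟩
      exact ⟨G, hG, p.2, hp⟩
    refine ⟨phaseGraph J (fun s => (f s).1) (fun s => (f s).2), ⟨J, _, _, ⟨?_, ?_, ?_⟩, ?_, rfl⟩,
      ?_⟩
    · rw [isOpen_iff_mem_nhds]
      intro s hs
      obtain ⟨G, hG, y, hy⟩ := hmemJ s hs
      obtain ⟨J', γ', v', h1, -, rfl, h4, -⟩ := hlocal G hG
      exact Filter.mem_of_superset (h1.1.mem_nhds (mem_phaseGraph.1 hy).1) h4
    · refine ⟨fun s hs t ht => ?_⟩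
      obtain ⟨G₁, hG₁, y₁, hy₁⟩ := hmemJ s hs
      obtain ⟨G₂, hG₂, y₂, hy₂⟩ := hmemJ t ht
      obtain ⟨G, hG, hy₁, hy₂⟩ : ∃ G ∈ c, (s, y₁) ∈ G ∧ (t, y₂) ∈ G := by
        rcases hchain.total hG₁ hG₂ with h | h
        · exact ⟨G₂, hG₂, h hy₁, hy₂⟩
        · exact ⟨G₁, hG₁, hy₁, h hy₂⟩
      obtain ⟨J', γ', v', h1, -, rfl, h4, -⟩ := hlocal G hG
      exact (h1.2.1.out (mem_phaseGraph.1 hy₁).1 (mem_phaseGraph.1 hy₂).1).trans h4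
    · obtain ⟨G, hG⟩ := hne
      obtain ⟨J', γ', v', h1, -, -, h4, -⟩ := hlocal G hG
      exact h1.2.2.mono h4
    · refine isTrajectory_of_local fun s hs => ?_
      obtain ⟨G, hG, y, hy⟩ := hmemJ s hs
      obtain ⟨J', γ', v', h1, h2, rfl, h4, h5, h6⟩ := hlocal G hG
      exact ⟨J', γ', v', h1.1, (mem_phaseGraph.1 hy).1, h2, h5, h6⟩
    · intro G hG
      obtain ⟨J', γ', v', h1, h2, rfl, h4, h5, h6⟩ := hlocal G hG
      intro p hp
      rw [mem_phaseGraph] at hp ⊢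
      exact ⟨h4 hp.1, by rw [hp.2]; exact Prod.ext (h5 hp.1).symm (h6 hp.1).symm⟩)
    (phaseGraph J₀ γ₀ v₀) ⟨J₀, γ₀, v₀, hJ₀, h₀, rfl⟩
  have hsub : ∀ s ∈ J₀, s ∈ J ∧ (γ₀ s, v₀ s) = (γ s, v s) := fun s hs =>
    mem_phaseGraph.1 (hG₀ ⟨s, hs, rfl⟩)
  refine ⟨J, γ, v, hJ, fun s hs => (hsub s hs).1,
    fun s hs => (congrArg Prod.fst (hsub s hs).2).symm,
    fun s hs => (congrArg Prod.snd (hsub s hs).2).symm, htraj, ?_⟩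
  intro J' hJ' hJJ' γ' v' htraj' heq
  have hveq := htraj.velocity_eqOn hJ.1 hJJ'.1 htraj' heq
  refine hJJ'.2 fun s hs => ?_
  have hle : phaseGraph J γ v ⊆ phaseGraph J' γ' v' := fun p hp => by
    rw [mem_phaseGraph] at hp ⊢
    exact ⟨hJJ'.1 hp.1, by rw [hp.2, heq hp.1, hveq hp.1]⟩
  exact (mem_phaseGraph.1 (hmax ⟨J', γ', v', hJ', htraj', rfl⟩ hle ⟨s, hs, rfl⟩)).1

/-! ### Local existence, and incompleteness in the nonquadratic case -/

theorem contDiff_force {n : ℕ} {a : ℕ → ℝ → ℂ} (ha : ∀ m, ContDiff ℝ 1 (a m)) :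
    ContDiff ℝ 1 (fun p : ℝ × ℂ => force n (fun m => a m p.1) p.2) := by
  unfold force
  refine (Complex.conjCLE.contDiff.comp (ContDiff.sum fun m _ => ?_)).neg
  exact (contDiff_const.mul ((ha m).comp contDiff_fst)).mul (contDiff_snd.pow _)

theorem neg_gradient_eq_force {V : ℂ → ℝ → ℝ} {n : ℕ} {a : ℕ → ℝ → ℂ} {u : ℝ}
    (hVa : ∀ z, V z u = (∑ m ∈ Finset.range (n + 1), a m u * z ^ m).re) (z : ℂ) :
    -(gradient (fun z : ℂ => V z u) z) = force n (fun m => a m u) z := by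
  rw [funext hVa, gradient_re_sum (fun m => a m u), force]

/-- Local existence of trajectories, for a potential with `C¹` coefficients. -/
theorem exists_local_trajectory {V : ℂ → ℝ → ℝ} {n : ℕ} {a : ℕ → ℝ → ℂ}
    (ha : ∀ m, ContDiff ℝ 1 (a m)) {u₀ κ : ℝ} (hκ : 0 < κ)
    (hVa : ∀ u ∈ Ioo (u₀ - κ) (u₀ + κ), ∀ z,
      V z u = (∑ m ∈ Finset.range (n + 1), a m u * z ^ m).re) (z₀ v₀ : ℂ) :
    ∃ ε > 0, ∃ γ v : ℝ → ℂ, γ u₀ = z₀ ∧ v u₀ = v₀ ∧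
      IsTrajectory V (Ioo (u₀ - ε) (u₀ + ε)) γ v := by
  set X : ℝ × ℂ × ℂ → ℝ × ℂ × ℂ := fun p => (1, p.2.2, force n (fun m => a m p.1) p.2.1) with hX
  have hXc : ContDiff ℝ 1 X := by
    have hpair : ContDiff ℝ 1 (fun p : ℝ × ℂ × ℂ => (p.1, p.2.1)) := by fun_prop
    have hvel : ContDiff ℝ 1 (fun p : ℝ × ℂ × ℂ => p.2.2) := by fun_prop
    have hforce := (contDiff_force (n := n) ha).comp hpair
    exact contDiff_const.prodMk (hvel.prodMk hforce)
  obtain ⟨α, hα₀, ε, hε, hα⟩ := (hXc.contDiffAt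
    (x := (u₀, z₀, v₀))).exists_forall_mem_closedBall_exists_eq_forall_mem_Ioo_hasDerivAt₀ u₀
  have hd1 : ∀ t ∈ Ioo (u₀ - ε) (u₀ + ε), HasDerivAt (fun t => (α t).1) 1 t := fun t ht =>
    (hasFDerivAt_fst (𝕜 := ℝ) (p := α t)).comp_hasDerivAt t (hα t ht)
  have hd2 : ∀ t ∈ Ioo (u₀ - ε) (u₀ + ε), HasDerivAt (fun t => (α t).2) (X (α t)).2 t :=
    fun t ht => (hasFDerivAt_snd (𝕜 := ℝ) (p := α t)).comp_hasDerivAt t (hα t ht)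
  -- The first component of the autonomous system is time itself.
  have htime : ∀ t ∈ Ioo (u₀ - ε) (u₀ + ε), (α t).1 = t := by
    intro t ht
    have hu₀ : u₀ ∈ Ioo (u₀ - ε) (u₀ + ε) := ⟨by linarith, by linarith⟩
    have hd : ∀ s ∈ Ioo (u₀ - ε) (u₀ + ε), HasDerivAt (fun t => (α t).1 - t) 0 s := fun s hs => by
      exact ((hd1 s hs).sub (hasDerivAt_id s)).congr_deriv (sub_self 1)
    have := isOpen_Ioo.is_const_of_deriv_eq_zero isPreconnected_Ioo
      (fun s hs => (hd s hs).differentiableAt.differentiableWithinAt)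
      (fun s hs => (hd s hs).deriv) ht hu₀
    simp only [hα₀, sub_self] at this
    linarith
  refine ⟨min ε κ, lt_min hε hκ, fun t => (α t).2.1, fun t => (α t).2.2, by simp [hα₀],
    by simp [hα₀], fun s hs => ?_⟩
  have hsε : s ∈ Ioo (u₀ - ε) (u₀ + ε) := ⟨by linarith [hs.1, min_le_left ε κ],
    by linarith [hs.2, min_le_left ε κ]⟩
  have hsκ : s ∈ Ioo (u₀ - κ) (u₀ + κ) := ⟨by linarith [hs.1, min_le_right ε κ],
    by linarith [hs.2, min_le_right ε κ]⟩
  constructor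
  · exact ((hasFDerivAt_fst (𝕜 := ℝ) (p := (α s).2)).comp_hasDerivAt s
      (hd2 s hsε)).hasDerivWithinAt
  · rw [neg_gradient_eq_force (hVa s hsκ)]
    have h := (hasFDerivAt_snd (𝕜 := ℝ) (p := (α s).2)).comp_hasDerivAt s (hd2 s hsε)
    have e : force n (fun m => a m s) (α s).2.1 = (X (α s)).2.2 := by
      simp only [hX, htime s hsε]
    rw [e]
    exact h.hasDerivWithinAt

/-- A potential with complete trajectories is quadratic: otherwise a trajectory that starts
radially along a direction of steepest decrease of the leading part blows up in finite time. -/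
theorem atMostQuadratic_of_complete {V : ℂ → ℝ → ℝ} (hV : IsHarmonicPotential V)
    (hb : PolynomiallyUBounded V) (hcomp : HasCompleteTrajectories V) : AtMostQuadratic V := by
  by_contra hnot
  obtain ⟨n, hn, u₀, κ, hκ, a, ha, hVa, hne⟩ := exists_leading_coeff hV hb hnot
  have hn' : (3 : ℝ) ≤ n := by exact_mod_cast hn
  have hpi := Real.pi_pos
  -- In the direction `φ` the leading term `aₙ zⁿ` is a negative real number.
  set φ : ℝ := (Real.pi - arg (a n u₀)) / n with hφ
  have hlead : a n u₀ * Complex.exp (n * (φ * I)) = -((‖a n u₀‖ : ℝ) : ℂ) := by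
    have h1 := Complex.norm_mul_exp_arg_mul_I (a n u₀)
    have h2 : (n : ℂ) * (φ * I) = Real.pi * I - arg (a n u₀) * I := by
      have : (n : ℂ) ≠ 0 := by exact_mod_cast (by omega : n ≠ 0)
      rw [hφ]
      push_cast
      field_simp
    rw [h2, Complex.exp_sub, Complex.exp_pi_mul_I]
    conv_lhs => rw [← h1]
    have := Complex.exp_ne_zero (arg (a n u₀) * I)
    simp only [h1]
    field_simp
    linear_combination h1
  set θ : ℝ := Real.pi / (4 * n) with hθ
  have hθ0 : 0 < θ := by positivity
  have hθn : n * θ = Real.pi / 4 := by rw [hθ]; field_simp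
  obtain ⟨R, hR, H⟩ := exists_sector_blowup_direction (φ := φ) (θ₀ := θ / 2) (θp := θ) hn ha hκ hVa
    (norm_pos_iff.2 hne) hlead (by positivity) (by linarith) (by rw [hθn]; linarith)
  have hθpi : θ < Real.pi := by nlinarith
  set e : ℂ := Complex.exp (φ * I) with he
  have hnorm : ‖e‖ = 1 := Complex.norm_exp_ofReal_mul_I φ
  obtain ⟨ε, hε, γ₀, v₀, hγ₀, hv₀, htraj₀⟩ :=
    exists_local_trajectory ha hκ hVa (e * ((R + 1 : ℝ) : ℂ)) (e * ((1 : ℝ) : ℂ))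
  have hu₀ : u₀ ∈ Ioo (u₀ - ε) (u₀ + ε) := ⟨by linarith, by linarith⟩
  obtain ⟨J, γ, v, hJ, hJ₀, hγ, hv, htraj, hinext⟩ :=
    exists_inextensible ⟨isOpen_Ioo, ordConnected_Ioo, ⟨u₀, hu₀⟩⟩ htraj₀
  have hJu : J = univ := hcomp J γ v hJ htraj hinext
  have hrot := radialVelocity_angularVelocity_rotate hnorm ((R + 1 : ℝ) : ℂ) ((1 : ℝ) : ℂ)
  have hlt := (H ⊤ γ v (EReal.coe_lt_top _) (htraj.mono (by rw [hJu]; exact subset_univ _)) ?_ ?_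
    ?_).2
  · exact not_top_lt hlt
  · rw [hγ hu₀, hγ₀, ← mul_assoc, he, ← Complex.exp_add, neg_add_cancel, Complex.exp_zero, one_mul]
    have hR1 : (0 : ℝ) ≤ R + 1 := by linarith
    refine mem_openSector_of_abs_arg_lt hR.le (by linarith) ?_ ?_
    · rw [Complex.norm_real, Real.norm_eq_abs, abs_of_nonneg hR1]
      linarith
    · rw [Complex.arg_ofReal_of_nonneg hR1, abs_zero]
      positivity
  · rw [hγ hu₀, hγ₀, hv hu₀, hv₀, hrot.1, radialVelocity]
    have hR1 : (0 : ℝ) < R + 1 := by linarith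
    have : 0 < ‖((R + 1 : ℝ) : ℂ)‖ := by
      rw [Complex.norm_real, Real.norm_eq_abs, abs_of_pos hR1]; exact hR1
    refine div_pos ?_ this
    simpa using hR1
  · rw [hγ hu₀, hγ₀, hv hu₀, hv₀, hrot.2, angularVelocity]
    simp

/-! ### Completeness in the quadratic case -/

/-- Picard–Lindelöf for a globally Lipschitz equation: the length of the interval of existence
does not depend on the initial value. -/
theorem exists_solution_uniform_step {E : Type*} [NormedAddCommGroup E] [NormedSpace ℝ E]
    [CompleteSpace E] {X : ℝ → E → E} {p : ℝ} {K A : NNReal}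
    (hLip : ∀ s ∈ Icc (p - 2) (p + 2), LipschitzWith K (X s))
    (hcont : ∀ x, Continuous fun s => X s x) (h0 : ∀ s ∈ Icc (p - 2) (p + 2), ‖X s 0‖ ≤ A) :
    ∃ h : ℝ, 0 < h ∧ h ≤ 1 ∧ ∀ s₁ ∈ Icc (p - 1) (p + 1), ∀ x₀ : E, ∃ y : ℝ → E, y s₁ = x₀ ∧
      ∀ s ∈ Ioo (s₁ - h) (s₁ + h), HasDerivAt y (X s (y s)) s := by
  set D : NNReal := 2 * K + A + 1 with hD
  have hD1 : (1 : ℝ) ≤ D := by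
    rw [hD]; push_cast; linarith [K.coe_nonneg, A.coe_nonneg]
  have hD0 : (0 : ℝ) < D := by linarith
  refine ⟨1 / D, by positivity, by rw [div_le_one hD0]; exact hD1, fun s₁ hs₁ x₀ => ?_⟩
  have hh1 : 1 / (D : ℝ) ≤ 1 := by rw [div_le_one hD0]; exact hD1
  have hh0 : 0 < 1 / (D : ℝ) := by positivity
  have hsub : ∀ s ∈ Icc (s₁ - 1 / D) (s₁ + 1 / D), s ∈ Icc (p - 2) (p + 2) := fun s hs =>
    ⟨by linarith [hs.1, hs₁.1], by linarith [hs.2, hs₁.2]⟩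
  have hPL : IsPicardLindelof X (tmin := s₁ - 1 / D) (tmax := s₁ + 1 / D)
      ⟨s₁, by linarith, by linarith⟩ x₀ (‖x₀‖₊ + 1) 0 (D * (‖x₀‖₊ + 1)) K := by
    refine ⟨fun s hs => (hLip s (hsub s hs)).lipschitzOnWith, fun x _ => (hcont x).continuousOn,
      fun s hs x hx => ?_, ?_⟩
    · have h1 := (hLip s (hsub s hs)).norm_sub_le x 0
      have h2 : ‖X s x‖ ≤ ‖X s x - X s 0‖ + ‖X s 0‖ := by
        simpa using norm_add_le (X s x - X s 0) (X s 0)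
      have h3 : ‖x‖ ≤ 2 * ‖x₀‖ + 1 := by
        have h4 : ‖x - x₀‖ ≤ ‖x₀‖ + 1 := by simpa [dist_eq_norm] using hx
        have h5 : ‖x‖ ≤ ‖x - x₀‖ + ‖x₀‖ := by simpa using norm_add_le (x - x₀) x₀
        linarith
      have h6 := h0 s (hsub s hs)
      rw [sub_zero] at h1
      have h7 : (K : ℝ) * ‖x‖ ≤ K * (2 * ‖x₀‖ + 1) := by gcongr
      rw [hD]
      push_cast
      have h8 := norm_nonneg x₀
      have h9 : 0 ≤ (A : ℝ) * ‖x₀‖ := by positivity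
      have h10 : 0 ≤ (K : ℝ) := K.coe_nonneg
      nlinarith
    · simp only [add_sub_cancel_left, sub_sub_cancel, max_self]
      push_cast
      rw [sub_zero]
      exact le_of_eq (by field_simp)
  obtain ⟨y, hy₀, hy⟩ := hPL.exists_eq_forall_mem_Icc_hasDerivWithinAt₀
  exact ⟨y, hy₀, fun s hs => (hy s (Ioo_subset_Icc_self hs)).hasDerivAt (Icc_mem_nhds hs.1 hs.2)⟩

theorem exists_Ioo_subset_of_ordConnected {J : Set ℝ} (hJ : IsOpen J) (hJ' : J.OrdConnected)
    {s t : ℝ} (hs : s ∈ J) (ht : t ∈ J) : ∃ a b, s ∈ Ioo a b ∧ t ∈ Ioo a b ∧ Ioo a b ⊆ J := by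
  obtain ⟨ε₁, hε₁, h₁⟩ := Metric.isOpen_iff.1 hJ s hs
  obtain ⟨ε₂, hε₂, h₂⟩ := Metric.isOpen_iff.1 hJ t ht
  rw [Real.ball_eq_Ioo] at h₁ h₂
  wlog hst : s ≤ t generalizing s t ε₁ ε₂
  · obtain ⟨a, b, h3, h4, h5⟩ := this ht hs ε₂ hε₂ h₂ ε₁ hε₁ h₁ (le_of_not_ge hst)
    exact ⟨a, b, h4, h3, h5⟩
  refine ⟨s - ε₁, t + ε₂, ⟨by linarith, by linarith⟩, ⟨by linarith, by linarith⟩, fun x hx => ?_⟩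
  rcases lt_or_ge x s with hxs | hxs
  · exact h₁ ⟨hx.1, by linarith⟩
  rcases lt_or_ge t x with hxt | hxt
  · exact h₂ ⟨by linarith, hx.2⟩
  · exact hJ'.out hs ht ⟨hxs, hxt⟩

theorem force_two (b : ℕ → ℂ) (z : ℂ) :
    force 2 b z = -(starRingEnd ℂ) (b 1 + 2 * b 2 * z) := by
  simp [force, Finset.sum_range_succ]

/-- For a quadratic potential the equation of motion is linear, hence all inextensible trajectories
are complete. -/
theorem complete_of_atMostQuadratic {V : ℂ → ℝ → ℝ} (hV : IsHarmonicPotential V)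
    (hquad : AtMostQuadratic V) : HasCompleteTrajectories V := by
  obtain ⟨a, ha, hVa⟩ := exists_contDiff_coeff (I := univ) (N := 2) hV.contDiff fun u _ => by
    obtain ⟨q, hq, hVq⟩ := hquad u
    obtain ⟨b, hb⟩ := exists_eq_re_sum_of_harmonic (hV.harmonic u) hq fun z => (hVq z).le
    exact ⟨b, fun z _ => hb z⟩
  set X : ℝ → ℂ × ℂ → ℂ × ℂ := fun s x => (x.2, force 2 (fun m => a m s) x.1) with hX
  have htrajX : ∀ {J : Set ℝ} {γ v : ℝ → ℂ}, IsOpen J → (IsTrajectory V J γ v ↔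
      ∀ s ∈ J, HasDerivAt (fun s => (γ s, v s)) (X s (γ s, v s)) s) := by
    intro J γ v hJ
    refine forall₂_congr fun s hs => ?_
    rw [neg_gradient_eq_force (hVa s (mem_univ s))]
    constructor
    · rintro ⟨h1, h2⟩
      exact (h1.hasDerivAt (hJ.mem_nhds hs)).prodMk (h2.hasDerivAt (hJ.mem_nhds hs))
    · intro h
      have h1 := (hasFDerivAt_fst (𝕜 := ℝ) (E := ℂ) (F := ℂ)).comp_hasDerivAt s h
      have h2 := (hasFDerivAt_snd (𝕜 := ℝ) (E := ℂ) (F := ℂ)).comp_hasDerivAt s h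
      exact ⟨h1.hasDerivWithinAt, h2.hasDerivWithinAt⟩
  intro J γ v hJ htraj hinext
  by_contra hne
  -- A finite end point `p` of `J` would be reached by a local solution started close to it.
  obtain ⟨p, hpcl, hpJ⟩ : ∃ p ∈ closure J, p ∉ J := by
    by_contra! hcon
    exact hne (IsClopen.eq_univ ⟨closure_subset_iff_isClosed.1 hcon, hJ.1⟩ hJ.2.2)
  obtain ⟨A, hA⟩ : ∃ A : NNReal, ∀ s ∈ Icc (p - 2) (p + 2), ‖a 1 s‖ + 2 * ‖a 2 s‖ ≤ A := by
    have hc : Continuous fun s => ‖a 1 s‖ + 2 * ‖a 2 s‖ :=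
      (ha 1).continuous.norm.add (continuous_const.mul (ha 2).continuous.norm)
    obtain ⟨B, hB⟩ := (isCompact_Icc (a := p - 2) (b := p + 2)).bddAbove_image hc.continuousOn
    exact ⟨B.toNNReal, fun s hs => (hB ⟨s, hs, rfl⟩).trans (Real.le_coe_toNNReal B)⟩
  have hLip : ∀ s ∈ Icc (p - 2) (p + 2), LipschitzWith (A + 1) (X s) := by
    intro s hs
    refine LipschitzWith.of_dist_le_mul fun x y => ?_
    have h1 : ‖x.1 - y.1‖ ≤ ‖x - y‖ := norm_fst_le (x - y)
    have h2 : ‖x.2 - y.2‖ ≤ ‖x - y‖ := norm_snd_le (x - y)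
    have h3 := hA s hs
    have h4 : 2 * ‖a 2 s‖ ≤ A := by linarith [norm_nonneg (a 1 s)]
    have h0 := norm_nonneg (x - y)
    have hA0 := A.coe_nonneg
    rw [dist_eq_norm, dist_eq_norm, Prod.norm_def]
    push_cast
    refine max_le ?_ ?_
    · change ‖x.2 - y.2‖ ≤ _
      nlinarith
    · change ‖force 2 (fun m => a m s) x.1 - force 2 (fun m => a m s) y.1‖ ≤ _
      rw [force_two, force_two, neg_sub_neg, ← map_sub, Complex.norm_conj,
        show a 1 s + 2 * a 2 s * y.1 - (a 1 s + 2 * a 2 s * x.1) = -(2 * a 2 s * (x.1 - y.1)) by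
          ring, norm_neg, norm_mul, norm_mul, Complex.norm_ofNat]
      calc 2 * ‖a 2 s‖ * ‖x.1 - y.1‖ ≤ A * ‖x - y‖ := by gcongr
        _ ≤ _ := by nlinarith
  obtain ⟨h, hh0, hh1, hsol⟩ := exists_solution_uniform_step (A := A) hLip
    (fun x => by
      simp only [hX]
      exact continuous_const.prodMk ((contDiff_force ha).continuous.comp
        (f := fun s : ℝ => (s, x.1)) (by fun_prop)))
    (fun s hs => by
      have h3 := hA s hs
      rw [Prod.norm_def]
      refine max_le (by simp [hX]) ?_
      simp only [hX, Prod.fst_zero, force_two, norm_neg, Complex.norm_conj, mul_zero, add_zero]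
      linarith [norm_nonneg (a 2 s)])
  obtain ⟨s₁, hs₁J, hs₁p⟩ := Metric.mem_closure_iff.1 hpcl h hh0
  rw [Real.dist_eq, abs_lt] at hs₁p
  obtain ⟨y, hy₁, hy⟩ := hsol s₁ ⟨by linarith, by linarith⟩ (γ s₁, v s₁)
  set U : Set ℝ := Ioo (s₁ - h) (s₁ + h) with hU
  have hs₁U : s₁ ∈ U := ⟨by linarith, by linarith⟩
  have hpU : p ∈ U := ⟨by linarith, by linarith⟩
  have hUsub : U ⊆ Icc (p - 2) (p + 2) := fun s hs => ⟨by linarith [hs.1], by linarith [hs.2]⟩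
  have hagree : EqOn (fun s => (γ s, v s)) y (J ∩ U) := by
    intro t ht
    obtain ⟨c, d, hs, ht, hsub⟩ := exists_Ioo_subset_of_ordConnected (hJ.1.inter isOpen_Ioo)
      (hJ.2.1.inter ordConnected_Ioo) ⟨hs₁J, hs₁U⟩ ht
    exact ODE_solution_unique_of_mem_Ioo (v := X) (s := fun _ => univ) (K := A + 1)
      (fun s hs => (hLip s (hUsub (hsub hs).2)).lipschitzOnWith) hs
      (fun s hs => ⟨(htrajX hJ.1).1 htraj s (hsub hs).1, mem_univ _⟩)
      (fun s hs => ⟨hy s (hsub hs).2, mem_univ _⟩) hy₁.symm ht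
  classical
  set γ' : ℝ → ℂ := fun s => if s ∈ J then γ s else (y s).1 with hγ'
  set v' : ℝ → ℂ := fun s => if s ∈ J then v s else (y s).2 with hv'
  have hγJ : EqOn γ' γ J := fun s hs => if_pos hs
  have hvJ : EqOn v' v J := fun s hs => if_pos hs
  have hγU : EqOn γ' (fun s => (y s).1) U := fun s hs => by
    by_cases hsJ : s ∈ J
    · exact (hγJ hsJ).trans (congrArg Prod.fst (hagree ⟨hsJ, hs⟩))
    · exact if_neg hsJ
  have hvU : EqOn v' (fun s => (y s).2) U := fun s hs => by
    by_cases hsJ : s ∈ J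
    · exact (hvJ hsJ).trans (congrArg Prod.snd (hagree ⟨hsJ, hs⟩))
    · exact if_neg hsJ
  have hJU : IsOpenInterval (J ∪ U) := by
    refine ⟨hJ.1.union isOpen_Ioo, ?_, hJ.2.2.mono subset_union_left⟩
    rw [← isPreconnected_iff_ordConnected]
    exact IsPreconnected.union s₁ hs₁J hs₁U (isPreconnected_iff_ordConnected.2 hJ.2.1)
      isPreconnected_Ioo
  refine hinext (J ∪ U) hJU ⟨subset_union_left, fun hsub => hpJ (hsub (Or.inr hpU))⟩ γ' v'
    (isTrajectory_of_local fun s hs => ?_) hγJ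
  rcases hs with hs | hs
  · exact ⟨J, γ, v, hJ.1, hs, htraj, hγJ, hvJ⟩
  · exact ⟨U, fun s => (y s).1, fun s => (y s).2, isOpen_Ioo, hs, (htrajX isOpen_Ioo).2 hy, hγU,
      hvU⟩

end PlanarPotential

theorem theorem3p7 :
    (∀ V : ℂ → ℝ → ℝ, PlanarPotential.IsHarmonicPotential V →
      PlanarPotential.PolynomiallyUBounded V → ¬ PlanarPotential.QuadraticallyUBounded V →
      ∀ (n : ℕ) (u₀ κ₀ : ℝ), 3 ≤ n → 0 < κ₀ → PlanarPotential.IsNormalizedAt V n u₀ κ₀ →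
      ∀ θ₀ θp : ℝ, 0 < θ₀ → θ₀ < θp → θp < Real.pi / (2 * n) →
      ∀ k : ℕ, k < n →
      ∃ ρ₀ : ℝ, 0 < ρ₀ ∧
        ∀ (b : EReal) (γ v : ℝ → ℂ), (u₀ : EReal) < b →
          PlanarPotential.IsTrajectory V (PlanarPotential.rightInterval u₀ b) γ v →
          PlanarPotential.IsRightInextensible V u₀ b γ →
          γ u₀ ∈ PlanarPotential.sector n k ρ₀ θ₀ →
          0 < PlanarPotential.radialVelocity (γ u₀) (v u₀) →
          PlanarPotential.angularVelocity (γ u₀) (v u₀) = 0 →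
          (∀ s ∈ PlanarPotential.rightInterval u₀ b,
            γ s ∈ PlanarPotential.sector n k ρ₀ θp) ∧
          b < ((u₀ + κ₀ : ℝ) : EReal)) ∧
    (∀ V : ℂ → ℝ → ℝ, PlanarPotential.IsHarmonicPotential V →
      PlanarPotential.PolynomiallyUBounded V →
      (PlanarPotential.HasCompleteTrajectories V ↔ PlanarPotential.AtMostQuadratic V)) := by
  refine ⟨fun V hV _ _ n u₀ κ₀ hn hκ₀ hnorm θ₀ θp hθ₀ hθ₀p hθp k _ => ?_, fun V hV hb =>
    ⟨PlanarPotential.atMostQuadratic_of_complete hV hb,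
      PlanarPotential.complete_of_atMostQuadratic hV⟩⟩
  obtain ⟨ρ₀, hρ₀, H⟩ :=
    PlanarPotential.sector_blowup_of_isNormalizedAt hV hn hκ₀ hnorm hθ₀ hθ₀p hθp k
  exact ⟨ρ₀, hρ₀, fun b γ v hb htraj _ hmem hrad hang => H b γ v hb htraj hmem hrad hang⟩
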